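/- For $\alpha,\beta\in\mathbb{C}$ with $\operatorname{Re}\alpha>0$ let $E_{\alpha,\beta}(z)=\sum_{k=0}^{\infty}\frac{z^k}{\Gamma(\alpha k+\beta)}$ be the two-parametric Mittag-Leffler function. Let $0<\alpha<1$ and $\beta>0$ be fixed real numbers, and for $p,q\in\mathbb{R}$ put $$J_{\alpha,\beta}(p,q)=\int_{|x|\le 1}E_{\alpha,\beta}\bigl(i(x^3+px+q)\bigr)\,dx,\qquad D=\frac{p^3}{27}+\frac{q^2}{4},$$ where $D$ is (up to a constant factor) the discriminant of the polynomial $x^3+px+q$. The series defining $E_{\alpha,\beta}$ converges for every $z\in\mathbb{C}$, the integrand is integrable on $[-1,1]$, and the following estimates hold. 1) If $\frac13\le\delta\le\frac12$, then there is a constant $c_\delta>0$, depending only on $\delta$ and the fixed parameters $\alpha,\beta$, such that $$|J_{\alpha,\beta}(p,q)|\le \frac{c_\delta}{\left(\frac{|p|^3}{27}+\frac{q^2}{4}\right)^{\frac{3\delta-1}{6}}}$$ for all real $p,q$ with $(p,q)\ne(0,0)$; for $\delta=\frac13$, where the denominator is read as $1$, this holds for $(p,q)=(0,0)$ too. 2)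 If $\frac12<\delta<1$, then there is a constant $c_\delta>0$, depending only on $\delta$ and the fixed parameters $\alpha,\beta$, such that $$|J_{\alpha,\beta}(p,q)|\le \frac{c_\delta}{|D|^{\delta-\frac12}\left(\frac{|p|^3}{27}+\frac{q^2}{4}\right)^{\frac{2-3\delta}{6}}}$$ for all real $p,q$ with $D\ne0$. -/

import Mathlib

/-- The two-parametric Mittag-Leffler function
`E_{α,β}(z) = ∑_{k ≥ 0} z ^ k / Γ(α k + β)`. At the poles of `Γ` the quotient is `0`, which is the
value of the entire function `1 / Γ` there. -/
noncomputable def mittagLeffler (α β z : ℂ) : ℂ :=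
  ∑' k : ℕ, z ^ k / Complex.Gamma (α * k + β)

/-- The generalized oscillatory integral
`J_{α,β}(p, q) = ∫_{|x| ≤ 1} E_{α,β}(i (x ^ 3 + p x + q)) dx`. -/
noncomputable def cubicIntegral (α β p q : ℝ) : ℂ :=
  ∫ x in Set.Icc (-1 : ℝ) 1,
    mittagLeffler (α : ℂ) (β : ℂ) (Complex.I * ((x ^ 3 + p * x + q : ℝ) : ℂ))

/-- The discriminant `D = p ^ 3 / 27 + q ^ 2 / 4` of the cubic `x ^ 3 + p x + q`
(in Cardano's normalization). -/
noncomputable def cubicDisc (p q : ℝ) : ℝ :=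
  p ^ 3 / 27 + q ^ 2 / 4

/-- The quantity `|p| ^ 3 / 27 + q ^ 2 / 4`. -/
noncomputable def cubicSize (p q : ℝ) : ℝ :=
  |p| ^ 3 / 27 + q ^ 2 / 4

open Complex MeasureTheory Filter Set

/-! On the imaginary axis `E_{α,β}(iy)` is `O(1 / (1 + |y|))`, so `J` is at most a constant times
`cubicMass`, the integral of `1 / (1 + |f|)` with `f` the cubic. No cancellation in the integral
over `x` is used.

The decay (`exists_norm_mittagLeffler_le`) comes from Hankel's formula for `1 / Γ`. Inserted in the
series, it turns `E` into a contour integral of `e ^ s s ^ (-β) / (1 - z s ^ (-α))`. As `α < 1`, the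
contour can open at an angle `θ > π/2` with `α θ < π/2`; then `s ^ α` stays in a sector away from
the imaginary axis, and for `z = iy` the denominator is bounded below uniformly in `y`.

For `δ ≤ 1/2` the exponent of `cubicSize` is at most `1/12`, and crude bounds suffice
(`cubicMass_mul_cubicSize_rpow_le`): either `q` dominates, or `f` is monotone on `[-1, 1]` with a
large derivative, or `p, q` are bounded.

For `δ > 1/2`, `1 / (1 + |f|) ≤ |f| ^ (-δ)` is integrated over the whole line by means of the
complex roots. With `d` and `M` the smallest and largest distance between roots, the integral is
`O(M ^ (-δ) d ^ (1 - 2δ))` (`cubicMass_le_of_roots`). Since `|D|` is `O(d ^ 2 M ^ 4)` and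
`cubicSize` is comparable to `M ^ 6`, all powers cancel (`exists_cubicMass_mul_le`). -/

/-! ### Hankel's integral for the reciprocal Gamma function, in logarithmic coordinates. -/

theorem eventually_neg_mul_exp_add_le {c : ℝ} (hc : 0 < c) (a : ℝ) :
    ∀ᶠ x : ℝ in atTop, -c * Real.exp x + a * x ≤ -x := by
  filter_upwards [eventually_ge_atTop 0, eventually_ge_atTop (2 * (a + 1) / c)] with x hx0 hx
  have h1 := Real.quadratic_le_exp_of_nonneg hx0
  rw [div_le_iff₀ hc] at hx
  have h2 : c * (1 + x + x ^ 2 / 2) ≤ c * Real.exp x := by gcongr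
  nlinarith [mul_le_mul_of_nonneg_right hx hx0, mul_nonneg hc.le hx0]

theorem integrableOn_exp_neg_mul_exp_add {c : ℝ} (hc : 0 < c) (a ρ : ℝ) :
    IntegrableOn (fun x : ℝ => Real.exp (-c * Real.exp x + a * x)) (Ioi ρ) := by
  refine integrable_of_isBigO_exp_neg one_pos (by fun_prop) (Asymptotics.IsBigO.of_bound 1 ?_)
  filter_upwards [eventually_neg_mul_exp_add_le hc a] with x hx
  simpa using hx

theorem tendsto_exp_neg_mul_exp_add {c : ℝ} (hc : 0 < c) (a : ℝ) :
    Tendsto (fun x : ℝ => Real.exp (-c * Real.exp x + a * x)) atTop (nhds 0) :=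
  Real.tendsto_exp_atBot.comp
    (tendsto_atBot_mono' _ (eventually_neg_mul_exp_add_le hc a) tendsto_neg_atTop_atBot)

/-- The integrand `e ^ s s ^ (-w) ds` of Hankel's integral, in the coordinate `s = exp ζ`. -/
noncomputable def hankelKernel (w : ℝ) (ζ : ℂ) : ℂ := exp (exp ζ + (1 - w) * ζ)

/-- The integral of `h` along the contour that comes from `∞ - θ i` to `ρ - θ i`, goes up
to `ρ + θ i`, and returns to `∞ + θ i`. -/
noncomputable def hankelIntegral (θ ρ : ℝ) (h : ℂ → ℂ) : ℂ :=
  (∫ x : ℝ in Ioi ρ, h (x + θ * I)) - (∫ x : ℝ in Ioi ρ, h (x + (-θ : ℝ) * I)) +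
    I * ∫ y : ℝ in (-θ)..θ, h (ρ + y * I)

theorem differentiable_hankelKernel (w : ℝ) : Differentiable ℂ (hankelKernel w) := by
  unfold hankelKernel; fun_prop

theorem continuous_hankelKernel (w : ℝ) : Continuous (hankelKernel w) :=
  (differentiable_hankelKernel w).continuous

theorem norm_hankelKernel (w x y : ℝ) :
    ‖hankelKernel w (x + y * I)‖ = Real.exp (Real.cos y * Real.exp x + (1 - w) * x) := by
  rw [hankelKernel, norm_exp]
  congr 1
  have : ((1 : ℂ) - w) = ((1 - w : ℝ) : ℂ) := by push_cast; ring
  rw [add_re, this, re_ofReal_mul, exp_re]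
  simp
  ring

theorem integrableOn_hankelKernel (w ρ : ℝ) {y : ℝ} (hy : Real.cos y < 0) :
    IntegrableOn (fun x : ℝ => hankelKernel w (x + y * I)) (Ioi ρ) := by
  refine ((integrableOn_exp_neg_mul_exp_add (neg_pos.2 hy) (1 - w) ρ).mono' ?_ ?_)
  · exact ((continuous_hankelKernel w).comp (by fun_prop)).aestronglyMeasurable
  · exact .of_forall fun x => by rw [norm_hankelKernel, neg_neg]

theorem integrableOn_of_norm_le_hankelKernel {h : ℂ → ℂ} {w ρ y C : ℝ} (hy : Real.cos y < 0)
    (hh : ContinuousOn (fun x : ℝ => h (x + y * I)) (Ioi ρ))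
    (hle : ∀ x : ℝ, ρ < x → ‖h (x + y * I)‖ ≤ C * ‖hankelKernel w (x + y * I)‖) :
    IntegrableOn (fun x : ℝ => h (x + y * I)) (Ioi ρ) := by
  refine (((integrableOn_hankelKernel w ρ hy).norm.const_mul C).mono'
    (hh.aestronglyMeasurable measurableSet_Ioi) ?_)
  exact (ae_restrict_mem measurableSet_Ioi).mono fun x hx => hle x hx

/-- Moving the vertical side of the contour. -/
theorem hankelIntegral_eq_of_le {θ ρ ρ' : ℝ} (hθ : 0 ≤ θ) (hρ : ρ ≤ ρ') {h : ℂ → ℂ}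
    (hd : ∀ ζ : ℂ, |ζ.im| ≤ θ → DifferentiableAt ℂ h ζ)
    (h1 : IntegrableOn (fun x : ℝ => h (x + θ * I)) (Ioi ρ))
    (h2 : IntegrableOn (fun x : ℝ => h (x + (-θ : ℝ) * I)) (Ioi ρ)) :
    hankelIntegral θ ρ h = hankelIntegral θ ρ' h := by
  have key := integral_boundary_rect_eq_zero_of_differentiableOn h (ρ + (-θ : ℝ) * I) (ρ' + θ * I)
    (by
      intro ζ hζ
      refine (hd ζ ?_).differentiableWithinAt
      have := hζ.2
      simp only [add_im, ofReal_im, mul_im, ofReal_re, I_im, I_re] at this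
      rw [abs_le]
      simpa [uIcc_of_le (show -θ ≤ θ by linarith)] using this)
  simp only [add_re, add_im, ofReal_re, mul_re, I_re, ofReal_im, I_im, mul_im, mul_zero, mul_one,
    sub_zero, add_zero, zero_add, smul_eq_mul] at key
  have e1 := intervalIntegral.integral_interval_add_Ioi h1 (h1.mono_set (Ioi_subset_Ioi hρ))
  have e2 := intervalIntegral.integral_interval_add_Ioi h2 (h2.mono_set (Ioi_subset_Ioi hρ))
  rw [hankelIntegral, hankelIntegral, ← e1, ← e2]
  linear_combination -key

/-- Moving the horizontal sides of the contour. -/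
theorem integral_ray_sub_integral_ray (w ρ : ℝ) {a b c : ℝ} (hab : a ≤ b) (hc : 0 < c)
    (hcos : ∀ y ∈ Icc a b, Real.cos y ≤ -c) :
    (∫ x : ℝ in Ioi ρ, hankelKernel w (x + a * I)) - (∫ x : ℝ in Ioi ρ, hankelKernel w (x + b * I))
      = I * ∫ y : ℝ in a..b, hankelKernel w (ρ + y * I) := by
  have hA := integrableOn_hankelKernel w ρ (y := a) (by linarith [hcos a ⟨le_rfl, hab⟩])
  have hB := integrableOn_hankelKernel w ρ (y := b) (by linarith [hcos b ⟨hab, le_rfl⟩])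
  have t1 := intervalIntegral_tendsto_integral_Ioi ρ hA tendsto_id
  have t2 := intervalIntegral_tendsto_integral_Ioi ρ hB tendsto_id
  have t3 : Tendsto (fun R : ℝ => ∫ y : ℝ in a..b, hankelKernel w (R + y * I)) atTop (nhds 0) := by
    have := (tendsto_exp_neg_mul_exp_add hc (1 - w)).mul_const |b - a|
    rw [zero_mul] at this
    refine squeeze_zero_norm (fun R => ?_) this
    refine intervalIntegral.norm_integral_le_of_norm_le_const fun y hy => ?_
    rw [uIoc_of_le hab] at hy
    rw [norm_hankelKernel]
    have := hcos y ⟨hy.1.le, hy.2⟩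
    gcongr
  have t4 := (t1.sub t2).add (t3.const_mul I)
  rw [mul_zero, add_zero] at t4
  refine tendsto_nhds_unique t4 (tendsto_const_nhds.congr fun R => ?_)
  have key := integral_boundary_rect_eq_zero_of_differentiableOn (hankelKernel w) (ρ + a * I)
    (R + b * I) (differentiable_hankelKernel w).differentiableOn
  simp only [add_re, add_im, ofReal_re, mul_re, I_re, ofReal_im, I_im, mul_im, mul_zero, mul_one,
    sub_zero, add_zero, zero_add, smul_eq_mul] at key
  simp only [id]
  linear_combination -key

theorem integral_exp_neg_exp_add {a : ℝ} (ha : 0 < a) :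
    Integrable (fun x : ℝ => Real.exp (-Real.exp x + a * x)) ∧
    ∫ x : ℝ, Real.exp (-Real.exp x + a * x) = Real.Gamma a := by
  have himg : Real.exp '' univ = Ioi 0 := by rw [image_univ, Real.range_exp]
  have hder : ∀ x ∈ (univ : Set ℝ), HasDerivWithinAt Real.exp (Real.exp x) univ x :=
    fun x _ => (Real.hasDerivAt_exp x).hasDerivWithinAt
  have hinj : InjOn Real.exp univ := Real.exp_injective.injOn
  have hfun : ∀ x : ℝ, |Real.exp x| • (Real.exp (-Real.exp x) * Real.exp x ^ (a - 1)) =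
      Real.exp (-Real.exp x + a * x) := fun x => by
    rw [abs_of_pos (Real.exp_pos x), smul_eq_mul, ← Real.exp_mul, ← Real.exp_add, ← Real.exp_add]
    ring_nf
  have h1 := integrableOn_image_iff_integrableOn_abs_deriv_smul MeasurableSet.univ hder hinj
    (fun t => Real.exp (-t) * t ^ (a - 1))
  have h2 := integral_image_eq_integral_abs_deriv_smul MeasurableSet.univ hder hinj
    (fun t => Real.exp (-t) * t ^ (a - 1))
  simp only [hfun, himg, setIntegral_univ, integrableOn_univ] at h1 h2
  exact ⟨h1.1 (Real.GammaIntegral_convergent ha), by rw [← h2, Real.Gamma_eq_integral ha]⟩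

theorem hankelIntegral_hankelKernel_eq_pi (w ρ : ℝ) {θ : ℝ} (h1 : Real.pi / 2 < θ)
    (h2 : θ ≤ Real.pi) :
    hankelIntegral θ ρ (hankelKernel w) = hankelIntegral Real.pi ρ (hankelKernel w) := by
  have hc : 0 < -Real.cos θ := by
    have := Real.cos_neg_of_pi_div_two_lt_of_lt h1 (by linarith [Real.pi_pos]); linarith
  have hpos := Real.pi_pos
  have hcos : ∀ y ∈ Icc θ Real.pi, Real.cos y ≤ -(-Real.cos θ) := fun y hy => by
    rw [neg_neg]; exact Real.cos_le_cos_of_nonneg_of_le_pi (by linarith) hy.2 hy.1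
  have u := integral_ray_sub_integral_ray w ρ h2 hc hcos
  have l := integral_ray_sub_integral_ray w ρ (neg_le_neg h2) hc
    (fun y hy => by
      rw [← Real.cos_neg]; exact hcos _ ⟨by linarith [hy.2], by linarith [hy.1]⟩)
  have hi : ∀ a b : ℝ, IntervalIntegrable (fun y : ℝ => hankelKernel w (ρ + y * I)) volume a b :=
    fun a b => ((continuous_hankelKernel w).comp (by fun_prop)).intervalIntegrable a b
  have s1 := intervalIntegral.integral_add_adjacent_intervals (hi (-Real.pi) (-θ)) (hi (-θ) θ)
  have s2 := intervalIntegral.integral_add_adjacent_intervals (hi (-Real.pi) θ) (hi θ Real.pi)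
  rw [hankelIntegral, hankelIntegral, ← s2, ← s1]
  linear_combination u + l

theorem hankelKernel_add_pi (w x : ℝ) {y : ℝ} (hy : exp (y * I) = -1) :
    hankelKernel w (x + y * I) =
      exp ((1 - w) * (y * I)) * (Real.exp (-Real.exp x + (1 - w) * x) : ℝ) := by
  rw [hankelKernel, exp_add (x : ℂ), hy, ofReal_exp, ← exp_add]
  push_cast
  ring_nf

theorem exp_ofReal_neg_pi_mul_I : exp ((-Real.pi : ℝ) * I) = -1 := by
  rw [ofReal_neg, neg_mul, exp_neg, exp_pi_mul_I]; norm_num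

theorem hankelIntegral_pi_eq (w ρ ρ' : ℝ) :
    hankelIntegral Real.pi ρ (hankelKernel w) = hankelIntegral Real.pi ρ' (hankelKernel w) := by
  have h : ∀ a b : ℝ, a ≤ b →
      hankelIntegral Real.pi a (hankelKernel w) = hankelIntegral Real.pi b (hankelKernel w) :=
    fun a b hab => hankelIntegral_eq_of_le Real.pi_pos.le hab
      (fun ζ _ => differentiable_hankelKernel w ζ)
      (integrableOn_hankelKernel w a (by simp)) (integrableOn_hankelKernel w a (by simp))
  rcases le_total ρ ρ' with hle | hle
  · exact h _ _ hle
  · exact (h _ _ hle).symm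

/-- Let `ρ → -∞`. The vertical side vanishes because `1 - w > 0`, the two rays give `Γ(1 - w)` with
opposite phases, and the reflection formula finishes. -/
theorem hankelIntegral_of_mem_Ioo {w : ℝ} (h0 : 0 < w) (h1 : w < 1) (ρ : ℝ) :
    hankelIntegral Real.pi ρ (hankelKernel w) = 2 * Real.pi * I / Gamma w := by
  obtain ⟨hint, hval⟩ := integral_exp_neg_exp_add (a := 1 - w) (by linarith)
  have ray : ∀ y : ℝ, exp (y * I) = -1 →
      Tendsto (fun r : ℝ => ∫ x : ℝ in Ioi r, hankelKernel w (x + y * I)) atBot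
        (nhds (exp ((1 - w) * (y * I)) * (Real.Gamma (1 - w) : ℝ))) := fun y hy => by
    have := (aecover_Ioi (μ := volume) (tendsto_id (α := ℝ) (x := atBot)))
      |>.integral_tendsto_of_countably_generated
        ((hint.ofReal (𝕜 := ℂ)).const_mul (exp ((1 - w) * (y * I))))
    rw [integral_const_mul, integral_ofReal, hval] at this
    refine this.congr fun r => ?_
    simp_rw [hankelKernel_add_pi w _ hy]
    simp
  have arc : Tendsto (fun r : ℝ => ∫ y : ℝ in (-Real.pi)..Real.pi, hankelKernel w (r + y * I))
      atBot (nhds 0) := by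
    have ht : Tendsto (fun r : ℝ => Real.exp (1 + (1 - w) * r) * |Real.pi - -Real.pi|) atBot
        (nhds 0) := by
      have : Tendsto (fun r : ℝ => 1 + (1 - w) * r) atBot atBot :=
        tendsto_atBot_add_const_left _ _ (tendsto_id.const_mul_atBot (by linarith))
      simpa using (Real.tendsto_exp_atBot.comp this).mul_const |Real.pi - -Real.pi|
    refine squeeze_zero_norm' ?_ ht
    filter_upwards [eventually_le_atBot (0 : ℝ)] with r hr
    refine intervalIntegral.norm_integral_le_of_norm_le_const fun y _ => ?_
    rw [norm_hankelKernel]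
    have e1 : Real.exp r ≤ 1 := Real.exp_le_one_iff.2 hr
    have := Real.cos_le_one y
    have := Real.exp_pos r
    gcongr
    nlinarith
  have ht := ((ray _ exp_pi_mul_I).sub (ray _ exp_ofReal_neg_pi_mul_I)).add (arc.const_mul I)
  have hconst := tendsto_nhds_unique (tendsto_const_nhds.congr fun r =>
    hankelIntegral_pi_eq w ρ r) ht
  rw [hconst]
  have hG : Gamma (w : ℂ) ≠ 0 := by
    rw [Gamma_ofReal]; exact_mod_cast (Real.Gamma_pos_of_pos h0).ne'
  have hs : sin (Real.pi * w : ℂ) ≠ 0 := by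
    rw [← ofReal_mul, ← ofReal_sin]
    exact_mod_cast (Real.sin_pos_of_pos_of_lt_pi (by positivity)
      (by nlinarith [Real.pi_pos])).ne'
  have hrefl := Complex.Gamma_mul_Gamma_one_sub w
  rw [eq_div_iff hs] at hrefl
  rw [eq_div_iff hG, ← Gamma_ofReal]
  push_cast
  have e1 : exp ((1 - w) * (Real.pi * I)) = -exp (-(Real.pi * w) * I) := by
    rw [show ((1 - w) * (Real.pi * I) : ℂ) = Real.pi * I + -(Real.pi * w) * I by ring, exp_add,
      exp_pi_mul_I]; ring
  have e2 : exp ((1 - w) * (-Real.pi * I)) = -exp (Real.pi * w * I) := by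
    rw [show ((1 - w) * (-Real.pi * I) : ℂ) = (-Real.pi : ℝ) * I + (Real.pi * w) * I by
      push_cast; ring, exp_add, exp_ofReal_neg_pi_mul_I]; ring
  have e3 := two_sin (Real.pi * w : ℂ)
  rw [e1, e2]
  linear_combination 2 * I * hrefl - Gamma (1 - w) * Gamma w * I * e3 +
     Gamma (1 - w) * Gamma w * (exp (Real.pi * w * I) - exp (-(Real.pi * w) * I)) * I_mul_I

/-- At `w = 1` the roles are exchanged: the rays cancel and the vertical side carries the residue at
`s = 0`. -/
theorem hankelIntegral_one (ρ : ℝ) :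
    hankelIntegral Real.pi ρ (hankelKernel 1) = 2 * Real.pi * I := by
  have arc : Tendsto (fun r : ℝ =>
      (∫ y : ℝ in (-Real.pi)..Real.pi, hankelKernel 1 (r + y * I)) - 2 * Real.pi)
      atBot (nhds 0) := by
    have ht : Tendsto (fun r : ℝ => 2 * Real.exp r * |Real.pi - -Real.pi|) atBot (nhds 0) := by
      simpa using (Real.tendsto_exp_atBot.const_mul 2).mul_const |Real.pi - -Real.pi|
    refine squeeze_zero_norm' ?_ ht
    filter_upwards [eventually_le_atBot (0 : ℝ)] with r hr
    have : (2 * Real.pi : ℂ) = ∫ y : ℝ in (-Real.pi)..Real.pi, (1 : ℂ) := by simp; ring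
    have hc : Continuous fun y : ℝ => hankelKernel 1 (r + y * I) :=
      (continuous_hankelKernel 1).comp (by fun_prop)
    rw [this, ← intervalIntegral.integral_sub (hc.intervalIntegrable _ _) (by simp)]
    refine intervalIntegral.norm_integral_le_of_norm_le_const fun y _ => ?_
    have hn : ‖exp (r + y * I)‖ = Real.exp r := by simp [norm_exp]
    have e1 : Real.exp r ≤ 1 := Real.exp_le_one_iff.2 hr
    rw [← hn]
    simpa [hankelKernel] using norm_exp_sub_one_le (x := exp (r + y * I)) (hn.trans_le e1)
  refine tendsto_nhds_unique (l := atBot)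
    (tendsto_const_nhds.congr fun r => hankelIntegral_pi_eq 1 ρ r) ?_
  have := (arc.const_mul I).add_const (2 * Real.pi * I)
  rw [mul_zero, zero_add] at this
  refine this.congr fun r => ?_
  rw [hankelIntegral]
  simp_rw [hankelKernel_add_pi 1 _ exp_pi_mul_I, hankelKernel_add_pi 1 _ exp_ofReal_neg_pi_mul_I]
  simp
  ring

theorem hasDerivAt_hankelKernel_add_one (w : ℝ) (ζ : ℂ) :
    HasDerivAt (hankelKernel (w + 1)) (hankelKernel w ζ - w * hankelKernel (w + 1) ζ) ζ := by
  have h := ((hasDerivAt_exp ζ).add ((hasDerivAt_id ζ).const_mul (1 - ((w + 1 : ℝ) : ℂ)))).cexp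
  have e : hankelKernel w ζ = hankelKernel (w + 1) ζ * exp ζ := by
    rw [hankelKernel, hankelKernel, ← exp_add]; push_cast; ring_nf
  rw [e]
  convert! h using 1
  simp [hankelKernel]
  ring_nf

/-- Integration by parts: the difference of the integrands is the derivative of `hankelKernel (w +
1)`, which vanishes at both ends of the contour. -/
theorem hankelIntegral_pi_recurrence (w ρ : ℝ) :
    hankelIntegral Real.pi ρ (hankelKernel w) =
      w * hankelIntegral Real.pi ρ (hankelKernel (w + 1)) := by
  have ray : ∀ y : ℝ, Real.cos y = -1 →
      (∫ x : ℝ in Ioi ρ, hankelKernel w (x + y * I)) -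
        w * (∫ x : ℝ in Ioi ρ, hankelKernel (w + 1) (x + y * I)) =
      - hankelKernel (w + 1) (ρ + y * I) := fun y hy => by
    have i1 := integrableOn_hankelKernel w ρ (y := y) (by rw [hy]; norm_num)
    have i2 := integrableOn_hankelKernel (w + 1) ρ (y := y) (by rw [hy]; norm_num)
    rw [← integral_const_mul, ← integral_sub i1 (i2.const_mul _), ← zero_sub]
    refine integral_Ioi_of_hasDerivAt_of_tendsto'
      (f := fun x : ℝ => hankelKernel (w + 1) (x + y * I)) (fun x _ => ?_)
      (i1.sub (i2.const_mul (w : ℂ))) ?_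
    · have h := (hasDerivAt_hankelKernel_add_one w (x + y * I)).comp x
        ((hasDerivAt_id x).ofReal_comp.add_const (y * I))
      convert! h using 1
      simp
    · rw [tendsto_zero_iff_norm_tendsto_zero]
      simp_rw [norm_hankelKernel, hy]
      exact tendsto_exp_neg_mul_exp_add one_pos _
  have arc : I * (∫ y : ℝ in (-Real.pi)..Real.pi, hankelKernel w (ρ + y * I)) -
      w * (I * ∫ y : ℝ in (-Real.pi)..Real.pi, hankelKernel (w + 1) (ρ + y * I)) =
      hankelKernel (w + 1) (ρ + Real.pi * I) - hankelKernel (w + 1) (ρ + (-Real.pi : ℝ) * I) := by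
    have c1 : Continuous fun y : ℝ => hankelKernel w (ρ + y * I) :=
      (continuous_hankelKernel w).comp (by fun_prop)
    have c2 : Continuous fun y : ℝ => hankelKernel (w + 1) (ρ + y * I) :=
      (continuous_hankelKernel _).comp (by fun_prop)
    rw [← intervalIntegral.integral_eq_sub_of_hasDerivAt
      (f := fun y : ℝ => hankelKernel (w + 1) (ρ + y * I))
      (f' := fun y : ℝ => I * hankelKernel w (ρ + y * I) -
        w * (I * hankelKernel (w + 1) (ρ + y * I)))
      (fun y _ => ?_) ((by fun_prop : Continuous _).intervalIntegrable _ _)]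
    · rw [intervalIntegral.integral_sub ((by fun_prop : Continuous _).intervalIntegrable _ _)
        ((by fun_prop : Continuous _).intervalIntegrable _ _)]
      simp only [intervalIntegral.integral_const_mul]
    · have h := (hasDerivAt_hankelKernel_add_one w (ρ + y * I)).comp y
        (((hasDerivAt_id y).ofReal_comp.mul_const I).const_add (ρ : ℂ))
      convert! h using 1
      simp
      ring
  rw [hankelIntegral, hankelIntegral]
  linear_combination ray _ Real.cos_pi - ray (-Real.pi) (by simp) + arc

/-- Hankel's integral for the reciprocal of the Gamma function. -/
theorem hankelIntegral_hankelKernel {w : ℝ} (hw : 0 < w) (ρ : ℝ) {θ : ℝ} (h1 : Real.pi / 2 < θ)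
    (h2 : θ ≤ Real.pi) :
    hankelIntegral θ ρ (hankelKernel w) = 2 * Real.pi * I / Gamma w := by
  rw [hankelIntegral_hankelKernel_eq_pi w ρ h1 h2]
  -- The recurrence climbs in unit steps from `(0, 1]`, following `Γ(w) = (w - 1) Γ(w - 1)`.
  have main : ∀ n : ℕ, ∀ w : ℝ, 0 < w → w ≤ n + 1 →
      hankelIntegral Real.pi ρ (hankelKernel w) = 2 * Real.pi * I / Gamma w := by
    intro n
    induction n with
    | zero =>
      intro w h0 hle
      rcases lt_or_eq_of_le hle with hlt | rfl
      · exact hankelIntegral_of_mem_Ioo h0 (by simpa using hlt) ρ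
      · simp [hankelIntegral_one]
    | succ n ih =>
      intro w h0 hle
      rcases le_or_gt w 1 with h | h
      · exact ih w h0 (by linarith [n.cast_nonneg (α := ℝ)])
      · have hv := ih (w - 1) (by linarith) (by push_cast at hle; linarith)
        have hne : ((w - 1 : ℝ) : ℂ) ≠ 0 := by exact_mod_cast (by linarith : 0 < w - 1).ne'
        rw [hankelIntegral_pi_recurrence, sub_add_cancel] at hv
        have hG := Gamma_add_one _ hne
        rw [show ((w - 1 : ℝ) : ℂ) + 1 = w by push_cast; ring] at hG
        rw [hG, ← mul_right_inj' hne, hv]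
        field_simp
  obtain ⟨n, hn⟩ := exists_nat_ge w
  exact main n w hw (by linarith)

/-! ### Contour integral for the Mittag-Leffler function and its decay on the imaginary axis. -/

theorem pow_mul_hankelKernel (α β : ℝ) (z ζ : ℂ) (k : ℕ) :
    z ^ k * hankelKernel (α * k + β) ζ = hankelKernel β ζ * (z * exp (-(α * ζ))) ^ k := by
  rw [mul_pow, ← exp_nat_mul, mul_left_comm, hankelKernel, hankelKernel, ← exp_add]
  push_cast
  ring_nf

theorem norm_mul_exp_le {α ρ : ℝ} (hα : 0 ≤ α) {z : ℂ} (hz : 2 * ‖z‖ ≤ Real.exp (α * ρ))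
    {x : ℝ} (hx : ρ ≤ x) (y : ℝ) : ‖z * exp (-(α * (x + y * I)))‖ ≤ 1 / 2 := by
  rw [norm_mul, norm_exp]
  have e : (-(α * (x + y * I)) : ℂ).re = -(α * x) := by simp
  have h1 : Real.exp (α * ρ) ≤ Real.exp (α * x) := by gcongr
  rw [e, Real.exp_neg, ← div_eq_mul_inv, div_le_iff₀ (Real.exp_pos _)]
  linarith

theorem hasSum_geometric_hankelKernel {α ρ : ℝ} (hα : 0 ≤ α) (β : ℝ) {z : ℂ}
    (hz : 2 * ‖z‖ ≤ Real.exp (α * ρ)) {x : ℝ} (hx : ρ ≤ x) (y : ℝ) :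
    HasSum (fun k : ℕ => z ^ k * hankelKernel (α * k + β) (x + y * I))
      (hankelKernel β (x + y * I) * (1 - z * exp (-(α * (x + y * I))))⁻¹) := by
  simp_rw [pow_mul_hankelKernel]
  exact (hasSum_geometric_of_norm_lt_one
    ((norm_mul_exp_le hα hz hx y).trans_lt (by norm_num))).mul_left _

theorem norm_pow_mul_hankelKernel_le {α ρ : ℝ} (hα : 0 ≤ α) (β : ℝ) {z : ℂ}
    (hz : 2 * ‖z‖ ≤ Real.exp (α * ρ)) {x : ℝ} (hx : ρ ≤ x) (y : ℝ) (k : ℕ) :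
    ‖z ^ k * hankelKernel (α * k + β) (x + y * I)‖ ≤
      (1 / 2) ^ k * ‖hankelKernel β (x + y * I)‖ := by
  rw [pow_mul_hankelKernel, norm_mul, norm_pow, mul_comm]
  gcongr
  exact norm_mul_exp_le hα hz hx y

/-- With `ρ` large the geometric ratio `z s ^ (-α)` is at most `1/2` in norm on the whole contour,
so sum and integral commute by dominated convergence. -/
theorem hasSum_hankelIntegral {α ρ θ : ℝ} (hα : 0 ≤ α) (β : ℝ) (hθ : Real.cos θ < 0) {z : ℂ}
    (hz : 2 * ‖z‖ ≤ Real.exp (α * ρ)) :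
    HasSum (fun k : ℕ => z ^ k * hankelIntegral θ ρ (hankelKernel (α * k + β)))
      (hankelIntegral θ ρ fun ζ => hankelKernel β ζ * (1 - z * exp (-(α * ζ)))⁻¹) := by
  have geom : Summable fun k : ℕ => (1 / 2 : ℝ) ^ k := summable_geometric_two
  have ray : ∀ y : ℝ, Real.cos y < 0 →
      HasSum (fun k : ℕ => z ^ k * ∫ x : ℝ in Ioi ρ, hankelKernel (α * k + β) (x + y * I))
        (∫ x : ℝ in Ioi ρ,
          hankelKernel β (x + y * I) * (1 - z * exp (-(α * (x + y * I))))⁻¹) := fun y hy => by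
    simp_rw [← integral_const_mul]
    refine hasSum_integral_of_dominated_convergence
      (fun k x => (1 / 2) ^ k * ‖hankelKernel β (x + y * I)‖) (fun k => ?_) (fun k => ?_)
      (.of_forall fun x => geom.mul_right _) ?_ ?_
    · exact (continuous_const.mul ((continuous_hankelKernel _).comp
        (by fun_prop))).aestronglyMeasurable
    · exact (ae_restrict_mem measurableSet_Ioi).mono fun x hx =>
        norm_pow_mul_hankelKernel_le hα β hz (le_of_lt hx) y k
    · simp_rw [tsum_mul_right]
      exact (integrableOn_hankelKernel β ρ hy).norm.const_mul _
    · exact (ae_restrict_mem measurableSet_Ioi).mono fun x hx =>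
        hasSum_geometric_hankelKernel hα β hz (le_of_lt hx) y
  have arc : HasSum (fun k : ℕ =>
        z ^ k * ∫ y : ℝ in (-θ)..θ, hankelKernel (α * k + β) (ρ + y * I))
      (∫ y : ℝ in (-θ)..θ,
        hankelKernel β (ρ + y * I) * (1 - z * exp (-(α * (ρ + y * I))))⁻¹) := by
    simp_rw [← intervalIntegral.integral_const_mul]
    refine intervalIntegral.hasSum_integral_of_dominated_convergence
      (fun k y => (1 / 2) ^ k * ‖hankelKernel β (ρ + y * I)‖) (fun k => ?_) (fun k => ?_)
      (.of_forall fun x _ => geom.mul_right _) ?_ ?_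
    · exact (continuous_const.mul ((continuous_hankelKernel _).comp
        (by fun_prop))).aestronglyMeasurable
    · exact .of_forall fun y _ => norm_pow_mul_hankelKernel_le hα β hz le_rfl y k
    · simp_rw [tsum_mul_right]
      exact (continuous_const.mul ((continuous_hankelKernel _).comp
        (by fun_prop)).norm).intervalIntegrable _ _
    · exact .of_forall fun y _ => hasSum_geometric_hankelKernel hα β hz le_rfl y
  convert! ((ray θ hθ).sub (ray (-θ) (by rwa [Real.cos_neg]))).add (arc.mul_left I) using 1
  ext k
  rw [hankelIntegral]
  ring

theorem hasSum_mittagLeffler_hankelIntegral {α β ρ θ : ℝ} (hα : 0 < α) (hβ : 0 < β)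
    (h1 : Real.pi / 2 < θ) (h2 : θ ≤ Real.pi) {z : ℂ} (hz : 2 * ‖z‖ ≤ Real.exp (α * ρ)) :
    HasSum (fun k : ℕ => z ^ k / Gamma ((α : ℂ) * k + (β : ℂ)))
      ((2 * Real.pi * I)⁻¹ *
        hankelIntegral θ ρ fun ζ => hankelKernel β ζ * (1 - z * exp (-(α * ζ)))⁻¹) := by
  have hcos := Real.cos_neg_of_pi_div_two_lt_of_lt h1 (by linarith [Real.pi_pos])
  convert! (hasSum_hankelIntegral hα.le β hcos hz).mul_left (2 * Real.pi * I)⁻¹ using 2 with k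
  rw [hankelIntegral_hankelKernel (by positivity) ρ h1 h2]
  have : (2 * Real.pi * I : ℂ) ≠ 0 := by simp [Real.pi_ne_zero]
  push_cast
  field_simp

theorem exists_two_mul_le_exp {α : ℝ} (hα : 0 < α) (r : ℝ) :
    ∃ ρ : ℝ, 0 ≤ ρ ∧ 2 * r ≤ Real.exp (α * ρ) := by
  refine ⟨max 0 (2 * r / α), le_max_left _ _, ?_⟩
  have h : 2 * r ≤ α * max 0 (2 * r / α) := by
    rw [← div_le_iff₀' hα]; exact le_max_right _ _
  linarith [Real.add_one_le_exp (α * max 0 (2 * r / α))]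

theorem summable_mittagLeffler {α β : ℝ} (hα : 0 < α) (hβ : 0 < β) (z : ℂ) :
    Summable fun k : ℕ => z ^ k / Gamma ((α : ℂ) * k + (β : ℂ)) := by
  obtain ⟨ρ, -, hρ⟩ := exists_two_mul_le_exp hα ‖z‖
  exact (hasSum_mittagLeffler_hankelIntegral hα hβ (by linarith [Real.pi_pos]) le_rfl hρ).summable

theorem continuous_mittagLeffler {α β : ℝ} (hα : 0 < α) (hβ : 0 < β) :
    Continuous (mittagLeffler α β) := by
  rw [continuous_iff_continuousAt]
  intro z
  have hs := (summable_mittagLeffler hα hβ (‖z‖ + 1 : ℝ)).norm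
  have : ContinuousOn (mittagLeffler α β) (Metric.ball 0 (‖z‖ + 1)) := by
    refine continuousOn_tsum (fun k => by fun_prop) hs fun k w hw => ?_
    rw [norm_div, norm_div, norm_pow, norm_pow, norm_real, Real.norm_of_nonneg (by positivity)]
    gcongr
    exact (mem_ball_zero_iff.1 hw).le
  exact this.continuousAt (Metric.isOpen_ball.mem_nhds (by simp))

/-- Multiply by the conjugate of `u`: the term `i y |u| ^ 2` is purely imaginary, so the real part
is `u.re` whatever `y` is. -/
theorem le_norm_one_sub_I_mul {c : ℝ} {u : ℂ} (hu0 : u ≠ 0) (hu : c * ‖u‖ ≤ u.re) (y : ℝ) :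
    c ≤ ‖1 - I * y * u‖ := by
  have h1 : (((1 - I * y * u) * (starRingEnd ℂ) u)).re = u.re := by simp; ring
  have h2 := (re_le_norm ((1 - I * y * u) * (starRingEnd ℂ) u))
  rw [h1, norm_mul, RCLike.norm_conj] at h2
  exact le_of_mul_le_mul_right (hu.trans h2) (norm_pos_iff.2 hu0)

theorem abs_mul_norm_le_norm_one_sub_I_mul {c : ℝ} (hc : 0 < c) (hc1 : c ≤ 1) {u : ℂ}
    (hu0 : u ≠ 0) (hu : c * ‖u‖ ≤ u.re) (y : ℝ) :
    c / 2 * (|y| * ‖u‖) ≤ ‖1 - I * y * u‖ := by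
  have h1 := le_norm_one_sub_I_mul hu0 hu y
  have h2 : |y| * ‖u‖ ≤ 1 + ‖1 - I * y * u‖ := by
    have := norm_sub_le 1 (1 - I * y * u)
    simpa [norm_mul] using this
  nlinarith [norm_nonneg (1 - I * y * u)]

theorem cos_mul_norm_exp_le_re {α θ : ℝ} (hα : 0 < α) (hθ : α * θ ≤ Real.pi) {ζ : ℂ}
    (hζ : |ζ.im| ≤ θ) :
    Real.cos (α * θ) * ‖exp (-(α * ζ))‖ ≤ (exp (-(α * ζ))).re := by
  rw [norm_exp, exp_re, mul_comm]
  gcongr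
  have : (-(α * ζ) : ℂ).im = -(α * ζ.im) := by simp
  rw [this, Real.cos_neg, ← Real.cos_abs (α * ζ.im), abs_mul, abs_of_pos hα]
  exact Real.cos_le_cos_of_nonneg_of_le_pi (by positivity) hθ (by gcongr)

/-- The integral of the norm of the Hankel kernel along the contour. -/
noncomputable def hankelMass (w θ ρ : ℝ) : ℝ :=
  (∫ x : ℝ in Ioi ρ, ‖hankelKernel w (x + θ * I)‖) +
    (∫ x : ℝ in Ioi ρ, ‖hankelKernel w (x + (-θ : ℝ) * I)‖) +
    ∫ y : ℝ in (-θ)..θ, ‖hankelKernel w (ρ + y * I)‖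

theorem hankelMass_nonneg (w ρ : ℝ) {θ : ℝ} (hθ : 0 ≤ θ) : 0 ≤ hankelMass w θ ρ := by
  have := intervalIntegral.integral_nonneg_of_forall (μ := volume) (show -θ ≤ θ by linarith)
    (fun y : ℝ => norm_nonneg (hankelKernel w (ρ + y * I)))
  unfold hankelMass
  positivity

theorem norm_hankelIntegral_le {h : ℂ → ℂ} {w θ ρ M : ℝ} (hθ : 0 ≤ θ) (hcos : Real.cos θ < 0)
    (hle : ∀ ζ : ℂ, |ζ.im| ≤ θ → ‖h ζ‖ ≤ M * ‖hankelKernel w ζ‖) :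
    ‖hankelIntegral θ ρ h‖ ≤ M * hankelMass w θ ρ := by
  have ray : ∀ y : ℝ, |y| ≤ θ → Real.cos y < 0 → ‖∫ x : ℝ in Ioi ρ, h (x + y * I)‖ ≤
      M * ∫ x : ℝ in Ioi ρ, ‖hankelKernel w (x + y * I)‖ := fun y hy hc => by
    rw [← integral_const_mul]
    exact norm_integral_le_of_norm_le ((integrableOn_hankelKernel w ρ hc).norm.const_mul M)
      (.of_forall fun x => hle _ (by simpa using hy))
  have arc : ‖∫ y : ℝ in (-θ)..θ, h (ρ + y * I)‖ ≤
      M * ∫ y : ℝ in (-θ)..θ, ‖hankelKernel w (ρ + y * I)‖ := by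
    rw [← intervalIntegral.integral_const_mul]
    refine intervalIntegral.norm_integral_le_of_norm_le (by linarith)
      (.of_forall fun y hy => hle _ (by simpa [abs_le] using ⟨hy.1.le, hy.2⟩))
      ((continuous_const.mul ((continuous_hankelKernel _).comp
        (by fun_prop)).norm).intervalIntegrable _ _)
  have r1 := ray θ (abs_of_nonneg hθ).le hcos
  have r2 := ray (-θ) (by rw [abs_neg, abs_of_nonneg hθ]) (by rwa [Real.cos_neg])
  have n1 := norm_add_le ((∫ x : ℝ in Ioi ρ, h (x + θ * I)) -
    (∫ x : ℝ in Ioi ρ, h (x + (-θ : ℝ) * I))) (I * ∫ y : ℝ in (-θ)..θ, h (ρ + y * I))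
  have n2 := norm_sub_le (∫ x : ℝ in Ioi ρ, h (x + θ * I))
    (∫ x : ℝ in Ioi ρ, h (x + (-θ : ℝ) * I))
  rw [norm_mul, norm_I, one_mul] at n1
  rw [hankelIntegral, hankelMass]
  linarith

/-- The series argument needs `ρ` large depending on `y`. Since `α θ < π/2`, no pole `s ^ α = iy`
lies in the strip, and the vertical side can be moved back to `ρ = 0`, giving a contour independent
of `y`. -/
theorem two_pi_mul_mittagLeffler {α β θ y : ℝ} (hα : 0 < α) (hβ : 0 < β)
    (h1 : Real.pi / 2 < θ) (h2 : θ ≤ Real.pi) (h3 : α * θ < Real.pi / 2) :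
    mittagLeffler α β (I * y) = (2 * Real.pi * I)⁻¹ *
      hankelIntegral θ 0 fun ζ => hankelKernel β ζ * (1 - I * y * exp (-(α * ζ)))⁻¹ := by
  obtain ⟨ρ, hρ0, hρ⟩ := exists_two_mul_le_exp hα ‖I * (y : ℂ)‖
  have hpi := Real.pi_pos
  have hθ : 0 ≤ θ := by linarith
  have hcos := Real.cos_neg_of_pi_div_two_lt_of_lt h1 (by linarith)
  have hc : 0 < Real.cos (α * θ) := Real.cos_pos_of_mem_Ioo ⟨by nlinarith, h3⟩
  have lower : ∀ ζ : ℂ, |ζ.im| ≤ θ → Real.cos (α * θ) ≤ ‖1 - I * y * exp (-(α * ζ))‖ :=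
    fun ζ hζ => le_norm_one_sub_I_mul (exp_ne_zero _)
      (cos_mul_norm_exp_le_re hα (by linarith) hζ) y
  have hne : ∀ ζ : ℂ, |ζ.im| ≤ θ → 1 - I * y * exp (-(α * ζ)) ≠ 0 := fun ζ hζ =>
    norm_pos_iff.1 (hc.trans_le (lower ζ hζ))
  have hdiff : ∀ ζ : ℂ, |ζ.im| ≤ θ → DifferentiableAt ℂ
      (fun ζ => hankelKernel β ζ * (1 - I * y * exp (-(α * ζ)))⁻¹) ζ := fun ζ hζ =>
    (differentiable_hankelKernel β ζ).mul (DifferentiableAt.inv (by fun_prop) (hne ζ hζ))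
  have hint : ∀ t : ℝ, |t| ≤ θ → Real.cos t < 0 → IntegrableOn (fun x : ℝ =>
      hankelKernel β (x + t * I) * (1 - I * y * exp (-(α * (x + t * I))))⁻¹) (Ioi 0) := by
    intro t ht hct
    have him : ∀ x : ℝ, |(x + t * I : ℂ).im| ≤ θ := fun x => by simpa using ht
    refine integrableOn_of_norm_le_hankelKernel
      (h := fun ζ => hankelKernel β ζ * (1 - I * y * exp (-(α * ζ)))⁻¹) (w := β)
      (C := (Real.cos (α * θ))⁻¹) hct (fun x _ => ?_) fun x _ => ?_
    · exact ((hdiff _ (him x)).continuousAt.comp (f := fun x : ℝ => (x + t * I : ℂ))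
        (by fun_prop)).continuousWithinAt
    · rw [norm_mul, norm_inv, mul_comm]
      gcongr
      exact lower _ (him x)
  rw [hankelIntegral_eq_of_le hθ hρ0 hdiff (hint _ (abs_of_nonneg hθ).le hcos)
    (hint _ (by rw [abs_neg, abs_of_nonneg hθ]) (by rwa [Real.cos_neg]))]
  exact (hasSum_mittagLeffler_hankelIntegral hα hβ h1 h2 hρ).tsum_eq

/-- The Mittag-Leffler function decays like `1 / |y|` on the imaginary axis. -/
theorem exists_norm_mittagLeffler_le {α β : ℝ} (hα0 : 0 < α) (hα1 : α < 1) (hβ : 0 < β) :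
    ∃ C : ℝ, 0 < C ∧ ∀ y : ℝ, ‖mittagLeffler α β (I * y)‖ ≤ C / (1 + |y|) := by
  have hpi := Real.pi_pos
  -- The interval for `θ` is nonempty exactly because `α < 1`.
  obtain ⟨θ, h1, h2⟩ := exists_between (show Real.pi / 2 < min Real.pi (Real.pi / 2 / α) from
    lt_min (by linarith) (by rw [lt_div_iff₀ hα0]; nlinarith))
  have h3 : α * θ < Real.pi / 2 := by
    rw [mul_comm, ← lt_div_iff₀ hα0]; exact h2.trans_le (min_le_right _ _)
  replace h2 : θ ≤ Real.pi := h2.le.trans (min_le_left _ _)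
  have hθ : 0 ≤ θ := by linarith
  have hcos := Real.cos_neg_of_pi_div_two_lt_of_lt h1 (by linarith)
  have hc : 0 < Real.cos (α * θ) := Real.cos_pos_of_mem_Ioo ⟨by nlinarith, h3⟩
  set c := Real.cos (α * θ) with hcdef
  have hc1 : c ≤ 1 := Real.cos_le_one _
  have hB := hankelMass_nonneg β 0 hθ
  have hB' := hankelMass_nonneg (β - α) 0 hθ
  have hnorm : ‖(2 * Real.pi * I : ℂ)⁻¹‖ ≤ 1 := by
    rw [norm_inv]
    refine inv_le_one_of_one_le₀ ?_
    simp [abs_of_pos hpi]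
    linarith [Real.two_le_pi]
  have hval : ∀ y : ℝ, ‖mittagLeffler α β (I * y)‖ ≤ ‖hankelIntegral θ 0 fun ζ =>
      hankelKernel β ζ * (1 - I * y * exp (-(α * ζ)))⁻¹‖ := fun y => by
    rw [two_pi_mul_mittagLeffler hα0 hβ h1 h2 h3, norm_mul]
    exact mul_le_of_le_one_left (norm_nonneg _) hnorm
  have bound1 : ∀ y : ℝ, ‖mittagLeffler α β (I * y)‖ ≤ c⁻¹ * hankelMass β θ 0 := fun y =>
    (hval y).trans <| norm_hankelIntegral_le hθ hcos fun ζ hζ => by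
      rw [norm_mul, norm_inv, mul_comm]
      gcongr
      exact le_norm_one_sub_I_mul (exp_ne_zero _) (cos_mul_norm_exp_le_re hα0 (by linarith) hζ) y
  -- The denominator also dominates `|y| |s ^ (-α)|`; dividing by it shifts `β` to `β - α`. This may
  -- be negative, which is harmless since the kernel is integrable along the rays for every real
  -- weight.
  have bound2 : ∀ y : ℝ, |y| * ‖mittagLeffler α β (I * y)‖ ≤
      (c / 2)⁻¹ * hankelMass (β - α) θ 0 := fun y => by
    rcases eq_or_ne y 0 with rfl | hy
    · rw [abs_zero, zero_mul]; positivity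
    have hy' : 0 < |y| := abs_pos.2 hy
    rw [← le_div_iff₀' hy', mul_div_right_comm]
    refine (hval y).trans <| norm_hankelIntegral_le hθ hcos fun ζ hζ => ?_
    have hl := abs_mul_norm_le_norm_one_sub_I_mul hc hc1 (exp_ne_zero _)
      (cos_mul_norm_exp_le_re hα0 (by linarith) hζ) y
    have hk : hankelKernel β ζ = hankelKernel (β - α) ζ * exp (-(α * ζ)) := by
      rw [hankelKernel, hankelKernel, ← exp_add]; push_cast; ring_nf
    have hpos : 0 < ‖exp (-(α * ζ))‖ := norm_pos_iff.2 (exp_ne_zero _)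
    have hpos' : 0 < ‖1 - I * y * exp (-(α * ζ))‖ := lt_of_lt_of_le (by positivity) hl
    rw [norm_mul, norm_inv, hk, norm_mul, ← div_eq_mul_inv, div_le_iff₀ hpos']
    calc ‖hankelKernel (β - α) ζ‖ * ‖exp (-(α * ζ))‖
        = (c / 2)⁻¹ / |y| * ‖hankelKernel (β - α) ζ‖ *
            (c / 2 * (|y| * ‖exp (-(α * ζ))‖)) := by field_simp
      _ ≤ _ := by gcongr
  refine ⟨c⁻¹ * hankelMass β θ 0 + (c / 2)⁻¹ * hankelMass (β - α) θ 0 + 1, by positivity,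
    fun y => ?_⟩
  rw [le_div_iff₀ (by positivity)]
  linarith [bound1 y, bound2 y]

/-! ### The mass of the cubic, and the bound for `δ ≤ 1/2`. -/

/-- The integral of `1 / (1 + |x ^ 3 + p x + q|)` over `[-1, 1]`. -/
noncomputable def cubicMass (p q : ℝ) : ℝ :=
  ∫ x : ℝ in (-1)..1, 1 / (1 + |x ^ 3 + p * x + q|)

theorem continuous_one_div_one_add_abs_cubic (p q : ℝ) :
    Continuous fun x : ℝ => 1 / (1 + |x ^ 3 + p * x + q|) := by
  refine continuous_const.div (by fun_prop) fun x => ?_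
  positivity

theorem norm_cubicIntegral_le {α β C : ℝ}
    (h : ∀ y : ℝ, ‖mittagLeffler α β (I * y)‖ ≤ C / (1 + |y|)) (p q : ℝ) :
    ‖cubicIntegral α β p q‖ ≤ C * cubicMass p q := by
  rw [cubicMass, ← intervalIntegral.integral_const_mul, cubicIntegral,
    integral_Icc_eq_integral_Ioc, ← intervalIntegral.integral_of_le (by norm_num)]
  refine intervalIntegral.norm_integral_le_of_norm_le (by norm_num)
    (.of_forall fun x _ => ?_)
    ((continuous_const.mul (continuous_one_div_one_add_abs_cubic p q)).intervalIntegrable _ _)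
  rw [mul_one_div]
  exact h _

theorem cubicMass_nonneg (p q : ℝ) : 0 ≤ cubicMass p q :=
  intervalIntegral.integral_nonneg_of_forall (by norm_num) fun x => by positivity

theorem cubicMass_le_of_le {p q b : ℝ} (hb : 0 ≤ b)
    (h : ∀ x ∈ Icc (-1 : ℝ) 1, b ≤ |x ^ 3 + p * x + q|) : cubicMass p q ≤ 2 / (1 + b) := by
  have h1 : ∫ x : ℝ in (-1)..1, (1 / (1 + b) : ℝ) = 2 / (1 + b) := by
    rw [intervalIntegral.integral_const, smul_eq_mul]; ring
  rw [← h1]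
  refine intervalIntegral.integral_mono_on (by norm_num)
    ((continuous_one_div_one_add_abs_cubic p q).intervalIntegrable _ _) (by simp) fun x hx => ?_
  gcongr
  exact h x hx

theorem cubicMass_le_two (p q : ℝ) : cubicMass p q ≤ 2 := by
  simpa using cubicMass_le_of_le (p := p) (q := q) le_rfl fun x _ => abs_nonneg _

theorem cubicMass_mul_le_four {p q : ℝ} (h : 2 * (1 + |p|) ≤ |q|) : cubicMass p q * |q| ≤ 4 := by
  have hq : 0 < |q| := by linarith [abs_nonneg p]
  have key := cubicMass_le_of_le (p := p) (q := q) (b := |q| / 2) (by positivity) fun x hx => by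
    have hx1 : |x| ≤ 1 := abs_le.2 hx
    have h1 : |x ^ 3 + p * x| ≤ 1 + |p| := by
      refine (abs_add_le _ _).trans (add_le_add ?_ ?_)
      · rw [abs_pow]; exact pow_le_one₀ (abs_nonneg x) hx1
      · rw [abs_mul]; exact mul_le_of_le_one_right (abs_nonneg p) hx1
    have h2 := abs_sub_abs_le_abs_sub q (-(x ^ 3 + p * x))
    rw [abs_neg, sub_neg_eq_add, add_comm q] at h2
    linarith
  rw [le_div_iff₀ (by positivity)] at key
  linarith [cubicMass_nonneg p q]

theorem continuous_one_div_one_add_sq_cubic (p q : ℝ) :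
    Continuous fun x : ℝ => 1 / (1 + (x ^ 3 + p * x + q) ^ 2) := by
  refine continuous_const.div (by fun_prop) fun x => ?_
  positivity

theorem abs_arctan_sub_arctan_le (a b : ℝ) : |Real.arctan a - Real.arctan b| ≤ Real.pi := by
  have h1 := Real.arctan_lt_pi_div_two a
  have h2 := Real.neg_pi_div_two_lt_arctan a
  have h3 := Real.arctan_lt_pi_div_two b
  have h4 := Real.neg_pi_div_two_lt_arctan b
  rw [abs_le]
  constructor <;> linarith

theorem abs_mul_integral_one_div_one_add_sq_le {p q : ℝ} (hp : 4 ≤ |p|) :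
    |p| * ∫ x : ℝ in (-1)..1, 1 / (1 + (x ^ 3 + p * x + q) ^ 2) ≤ 4 * Real.pi := by
  -- The derivative has the constant sign `σ` of `p` and size at least `|p| / 4`, so it can be
  -- inserted to make the integrand the derivative of `arctan ∘ f`.
  obtain ⟨σ, hσ, hle⟩ : ∃ σ : ℝ, |σ| = 1 ∧ ∀ x ∈ Icc (-1 : ℝ) 1,
      |p| ≤ 4 * σ * (3 * x ^ 2 + p) := by
    rcases le_total 0 p with h | h
    · refine ⟨1, by simp, fun x _ => ?_⟩
      rw [abs_of_nonneg h]; nlinarith [sq_nonneg x]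
    · refine ⟨-1, by simp, fun x hx => ?_⟩
      rw [abs_of_nonpos h] at hp ⊢; nlinarith [hx.1, hx.2]
  have hcont : Continuous fun x : ℝ =>
      1 / (1 + (x ^ 3 + p * x + q) ^ 2) * (3 * x ^ 2 + p) :=
    (continuous_one_div_one_add_sq_cubic p q).mul (by fun_prop)
  have hftc : ∫ x : ℝ in (-1)..1, 1 / (1 + (x ^ 3 + p * x + q) ^ 2) * (3 * x ^ 2 + p) =
      Real.arctan (1 ^ 3 + p * 1 + q) - Real.arctan ((-1) ^ 3 + p * (-1) + q) := by
    refine intervalIntegral.integral_eq_sub_of_hasDerivAt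
      (f := fun x : ℝ => Real.arctan (x ^ 3 + p * x + q)) (fun x _ => ?_)
      (hcont.intervalIntegrable _ _)
    have h := (((hasDerivAt_pow 3 x).add ((hasDerivAt_id x).const_mul p)).add_const q).arctan
    convert! h using 1
    simp
  have hmono : ∫ x : ℝ in (-1)..1, |p| * (1 / (1 + (x ^ 3 + p * x + q) ^ 2)) ≤
      ∫ x : ℝ in (-1)..1,
        4 * σ * (1 / (1 + (x ^ 3 + p * x + q) ^ 2) * (3 * x ^ 2 + p)) := by
    refine intervalIntegral.integral_mono_on (by norm_num)
      ((continuous_const.mul (continuous_one_div_one_add_sq_cubic p q)).intervalIntegrable _ _)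
      ((continuous_const.mul hcont).intervalIntegrable _ _) fun x hx => ?_
    have : 0 ≤ 1 / (1 + (x ^ 3 + p * x + q) ^ 2) := by positivity
    nlinarith [mul_le_mul_of_nonneg_right (hle x hx) this]
  rw [intervalIntegral.integral_const_mul, intervalIntegral.integral_const_mul, hftc] at hmono
  refine hmono.trans ?_
  refine (le_abs_self _).trans ?_
  rw [abs_mul, abs_mul, hσ, mul_one, abs_of_pos (by norm_num : (0 : ℝ) < 4)]
  gcongr
  exact abs_arctan_sub_arctan_le _ _

/-- With `g = 1 / (1 + |f|)`, `√|p| g ≤ 1/2 + |p| g ^ 2 / 2` and `g ^ 2 ≤ 1 / (1 + f ^ 2)` reduce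
this to the arctangent bound. -/
theorem cubicMass_mul_sqrt_le {p q : ℝ} (hp : 4 ≤ |p|) :
    cubicMass p q * √|p| ≤ 1 + 2 * Real.pi := by
  have hp0 : 0 < |p| := by linarith
  have hs : 0 < √|p| := Real.sqrt_pos.2 hp0
  have hss : √|p| * √|p| = |p| := Real.mul_self_sqrt hp0.le
  have hmono : ∫ x : ℝ in (-1)..1, √|p| * (1 / (1 + |x ^ 3 + p * x + q|)) ≤
      ∫ x : ℝ in (-1)..1, (1 / 2 + |p| / 2 * (1 / (1 + (x ^ 3 + p * x + q) ^ 2))) := by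
    refine intervalIntegral.integral_mono_on (by norm_num)
      ((continuous_const.mul (continuous_one_div_one_add_abs_cubic p q)).intervalIntegrable _ _)
      ((continuous_const.add (continuous_const.mul
        (continuous_one_div_one_add_sq_cubic p q))).intervalIntegrable _ _) fun x _ => ?_
    set y := x ^ 3 + p * x + q
    have h1 : (1 / (1 + |y|)) ^ 2 ≤ 1 / (1 + y ^ 2) := by
      rw [div_pow, one_pow, ← sq_abs y]
      gcongr
      nlinarith [abs_nonneg y]
    nlinarith [sq_nonneg (√|p| * (1 / (1 + |y|)) - 1), mul_le_mul_of_nonneg_left h1 hp0.le]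
  have hc : Continuous fun x : ℝ => |p| / 2 * (1 / (1 + (x ^ 3 + p * x + q) ^ 2)) :=
    continuous_const.mul (continuous_one_div_one_add_sq_cubic p q)
  rw [intervalIntegral.integral_const_mul,
    intervalIntegral.integral_add (by simp) (hc.intervalIntegrable _ _),
    intervalIntegral.integral_const_mul, intervalIntegral.integral_const, smul_eq_mul] at hmono
  have := abs_mul_integral_one_div_one_add_sq_le (q := q) hp
  rw [mul_comm, cubicMass]
  linarith

theorem cubicSize_nonneg (p q : ℝ) : 0 ≤ cubicSize p q := by
  unfold cubicSize; positivity

/-- When `cubicSize ≤ b ^ 3` with `b ≥ 1`, its power is at most `b ^ (3e) ≤ √b`, which each regime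
can afford. The constant is generous: the cases give `4`, `1 + 2π` and `4`. -/
theorem cubicMass_mul_cubicSize_rpow_le {e : ℝ} (he0 : 0 ≤ e) (he : e ≤ 1 / 12) (p q : ℝ) :
    cubicMass p q * cubicSize p q ^ e ≤ 70 := by
  have hS := cubicSize_nonneg p q
  have hI := cubicMass_nonneg p q
  have hp := abs_nonneg p
  have hpi := Real.pi_lt_four
  have step : ∀ b : ℝ, 1 ≤ b → cubicSize p q ≤ b ^ 3 → cubicSize p q ^ e ≤ b ^ (1 / 2 : ℝ) := by
    intro b hb h
    calc cubicSize p q ^ e ≤ (b ^ 3) ^ e := by gcongr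
      _ = b ^ (3 * e) := by
        rw [← Real.rpow_natCast, ← Real.rpow_mul (by linarith)]; norm_num
      _ ≤ _ := Real.rpow_le_rpow_of_exponent_le hb (by linarith)
  rcases le_or_gt (2 * (1 + |p|)) |q| with hq | hq
  · have h1 : cubicSize p q ≤ |q| ^ 3 := by
      have e1 : |p| ^ 3 ≤ |q| ^ 3 := pow_le_pow_left₀ hp (by linarith) 3
      have e2 : 2 * |q| ^ 2 ≤ |q| ^ 3 := by nlinarith [sq_nonneg |q|]
      rw [cubicSize, ← sq_abs q]
      nlinarith
    have h2 := step |q| (by linarith) h1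
    have h3 : |q| ^ (1 / 2 : ℝ) ≤ |q| ^ (1 : ℝ) :=
      Real.rpow_le_rpow_of_exponent_le (by linarith) (by norm_num)
    rw [Real.rpow_one] at h3
    have := cubicMass_mul_le_four hq
    have := mul_le_mul_of_nonneg_left (h2.trans h3) hI
    linarith
  rcases le_or_gt 4 |p| with hp4 | hp4
  · have h1 : cubicSize p q ≤ |p| ^ 3 := by
      have e1 : |q| ^ 2 ≤ (5 / 2 * |p|) ^ 2 := by gcongr; linarith
      have e2 : 4 * |p| ^ 2 ≤ |p| ^ 3 := by nlinarith [sq_nonneg |p|]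
      rw [cubicSize, ← sq_abs q]
      nlinarith
    have h2 := step |p| (by linarith) h1
    rw [← Real.sqrt_eq_rpow] at h2
    have := cubicMass_mul_sqrt_le (q := q) hp4
    have := mul_le_mul_of_nonneg_left h2 hI
    linarith
  · have h1 : cubicSize p q ≤ 4 ^ 3 := by
      have e1 : |q| ^ 2 ≤ 10 ^ 2 := by gcongr; linarith
      have e2 : |p| ^ 3 ≤ 4 ^ 3 := by gcongr
      rw [cubicSize, ← sq_abs q]
      linarith
    have h2 := step 4 (by norm_num) h1
    rw [← Real.sqrt_eq_rpow, show (4 : ℝ) = 2 ^ 2 by norm_num,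
      Real.sqrt_sq (by norm_num)] at h2
    have := mul_le_mul (cubicMass_le_two p q) h2 (by positivity) (by norm_num)
    linarith

/-! ### Bounding the mass by the distances between the roots. -/

/-- An integrable majorant, centred at `0`, for `|x - z| ^ (-δ) |x - w| ^ (-δ)` with `|z - w| ≥ d`,
valid where `z` is the nearer of the two points. -/
noncomputable def pairKernel (δ d t : ℝ) : ℝ := |t| ^ (-δ) * (|t| + d) ^ (-δ)

theorem pairKernel_nonneg {d : ℝ} (hd : 0 ≤ d) (δ t : ℝ) : 0 ≤ pairKernel δ d t := by
  unfold pairKernel; positivity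

/-- Near `0` the condition is `δ < 1`; at infinity the decay `|t| ^ (-2δ)` needs `δ > 1/2`. -/
theorem integrable_pairKernel_one {δ : ℝ} (h1 : 1 / 2 < δ) (h2 : δ < 1) :
    Integrable (pairKernel δ 1) := by
  have hmeas : Measurable fun t : ℝ => t ^ (-δ) * (t + 1) ^ (-δ) := by fun_prop
  have hiff := integrable_fun_norm_addHaar (E := ℝ) volume (F := ℝ)
    (f := fun t => t ^ (-δ) * (t + 1) ^ (-δ))
  simp only [Module.finrank_self, Nat.sub_self, pow_zero, one_smul, Real.norm_eq_abs] at hiff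
  refine hiff.2 ?_
  rw [← Ioc_union_Ioi_eq_Ioi zero_le_one]
  refine IntegrableOn.union ?_ ?_
  · have hi : IntegrableOn (fun t : ℝ => t ^ (-δ)) (Ioc 0 1) := by
      rw [← intervalIntegrable_iff_integrableOn_Ioc_of_le zero_le_one]
      exact intervalIntegral.intervalIntegrable_rpow' (by linarith)
    refine hi.mono' hmeas.aestronglyMeasurable
      ((ae_restrict_mem measurableSet_Ioc).mono fun t ht => ?_)
    have ht0 : 0 < t := ht.1
    rw [Real.norm_of_nonneg (by positivity)]
    refine mul_le_of_le_one_right (by positivity) ?_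
    exact Real.rpow_le_one_of_one_le_of_nonpos (by linarith) (by linarith)
  · refine (integrableOn_Ioi_rpow_of_lt (a := -δ + -δ) (by linarith) one_pos).mono'
      hmeas.aestronglyMeasurable ((ae_restrict_mem measurableSet_Ioi).mono fun t ht => ?_)
    have ht0 : 0 < t := zero_lt_one.trans ht
    rw [Real.norm_of_nonneg (by positivity), Real.rpow_add ht0]
    gcongr ?_ * ?_
    exact Real.rpow_le_rpow_of_nonpos ht0 (by linarith) (by linarith)

theorem pairKernel_mul {d : ℝ} (hd : 0 < d) (δ t : ℝ) :
    pairKernel δ d (d * t) = d ^ (-δ - δ) * pairKernel δ 1 t := by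
  have e : |d * t| + d = d * (|t| + 1) := by rw [abs_mul, abs_of_pos hd]; ring
  rw [pairKernel, pairKernel, e, abs_mul, abs_of_pos hd, Real.mul_rpow hd.le (abs_nonneg t),
    Real.mul_rpow hd.le (by positivity), sub_eq_add_neg, Real.rpow_add hd]
  ring

theorem integrable_pairKernel {δ d : ℝ} (h1 : 1 / 2 < δ) (h2 : δ < 1) (hd : 0 < d) :
    Integrable (pairKernel δ d) := by
  rw [← integrable_comp_mul_left_iff _ hd.ne']
  simp_rw [pairKernel_mul hd]
  exact (integrable_pairKernel_one h1 h2).const_mul _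

theorem integral_pairKernel {d : ℝ} (hd : 0 < d) (δ : ℝ) :
    ∫ t, pairKernel δ d t = d ^ (1 - 2 * δ) * ∫ t, pairKernel δ 1 t := by
  have h := Measure.integral_comp_mul_left (pairKernel δ d) d
  simp_rw [pairKernel_mul hd, integral_const_mul] at h
  rw [smul_eq_mul, abs_of_pos (inv_pos.2 hd)] at h
  rw [eq_inv_mul_iff_mul_eq₀ hd.ne'] at h
  rw [← h, show 1 - 2 * δ = 1 + (-δ - δ) by ring, Real.rpow_add hd, Real.rpow_one]
  ring

theorem pairKernel_le_of_abs_le {δ d t a : ℝ} (hδ : 0 < δ) (hd : 0 < d) (ht : t ≠ 0)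
    (h : |t| ≤ a) : a ^ (-δ) * (a + d) ^ (-δ) ≤ pairKernel δ d t := by
  have ht' : 0 < |t| := abs_pos.2 ht
  have ha : 0 < a := ht'.trans_le h
  unfold pairKernel
  gcongr ?_ * ?_
  · exact Real.rpow_le_rpow_of_nonpos ht' h (by linarith)
  · exact Real.rpow_le_rpow_of_nonpos (by positivity) (by linarith) (by linarith)

theorem rpow_neg_mul_rpow_neg_le {δ d a b : ℝ} (hδ : 0 < δ) (hd : 0 < d) (ha : 0 < a)
    (hb : 0 < b) (h : d ≤ a + b) :
    a ^ (-δ) * b ^ (-δ) ≤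
      3 ^ δ * (a ^ (-δ) * (a + d) ^ (-δ) + b ^ (-δ) * (b + d) ^ (-δ)) := by
  have main : ∀ {a b : ℝ}, 0 < a → 0 < b → d ≤ a + b → a ≤ b →
      a ^ (-δ) * b ^ (-δ) ≤ 3 ^ δ * (a ^ (-δ) * (a + d) ^ (-δ)) := by
    intro a b ha hb h hab
    -- From `a ≤ b` and `d ≤ a + b` follows `a + d ≤ 3b`.
    have h1 : b ^ (-δ) ≤ ((a + d) / 3) ^ (-δ) :=
      Real.rpow_le_rpow_of_nonpos (by positivity) (by linarith) (by linarith)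
    have h2 : ((a + d) / 3) ^ (-δ) = 3 ^ δ * (a + d) ^ (-δ) := by
      rw [Real.div_rpow (by positivity) (by norm_num), Real.rpow_neg (by norm_num : (0 : ℝ) ≤ 3),
        div_inv_eq_mul, mul_comm]
    rw [h2] at h1
    calc a ^ (-δ) * b ^ (-δ) ≤ a ^ (-δ) * (3 ^ δ * (a + d) ^ (-δ)) := by gcongr
      _ = _ := by ring
  have n1 : 0 ≤ (3 : ℝ) ^ δ * (a ^ (-δ) * (a + d) ^ (-δ)) := by positivity
  have n2 : 0 ≤ (3 : ℝ) ^ δ * (b ^ (-δ) * (b + d) ^ (-δ)) := by positivity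
  rcases le_total a b with hab | hab
  · linarith [main ha hb h hab]
  · linarith [main hb ha (by linarith) hab]

theorem rpow_neg_norm_mul_le {δ d x : ℝ} {z w : ℂ} (hδ : 0 < δ) (hd : 0 < d) (hzw : d ≤ ‖z - w‖)
    (hz : x ≠ z.re) (hw : x ≠ w.re) :
    ‖(x : ℂ) - z‖ ^ (-δ) * ‖(x : ℂ) - w‖ ^ (-δ) ≤
      3 ^ δ * (pairKernel δ d (x - z.re) + pairKernel δ d (x - w.re)) := by
  have re_le : ∀ z : ℂ, |x - z.re| ≤ ‖(x : ℂ) - z‖ := fun z => by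
    simpa using abs_re_le_norm ((x : ℂ) - z)
  have hz0 := sub_ne_zero.2 hz
  have hw0 := sub_ne_zero.2 hw
  have hsum : d ≤ ‖(x : ℂ) - z‖ + ‖(x : ℂ) - w‖ := by
    have := norm_sub_le ((x : ℂ) - w) (x - z)
    rw [sub_sub_sub_cancel_left] at this
    linarith
  refine (rpow_neg_mul_rpow_neg_le hδ hd ((abs_pos.2 hz0).trans_le (re_le z))
    ((abs_pos.2 hw0).trans_le (re_le w)) hsum).trans ?_
  gcongr
  · exact pairKernel_le_of_abs_le hδ hd hz0 (re_le z)
  · exact pairKernel_le_of_abs_le hδ hd hw0 (re_le w)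

theorem one_div_one_add_le_rpow_neg {δ a : ℝ} (h0 : 0 ≤ δ) (h1 : δ ≤ 1) (ha : 0 < a) :
    1 / (1 + a) ≤ a ^ (-δ) := by
  rw [Real.rpow_neg ha.le, one_div]
  gcongr
  rcases le_total a 1 with h | h
  · linarith [Real.rpow_le_one ha.le h h0]
  · have := Real.rpow_le_rpow_of_exponent_le h h1
    rw [Real.rpow_one] at this
    linarith

/-- Two roots are `M` apart, so one of them is at distance at least `M / 2` from `x`. Its factor is
pulled out, and the other two roots, at least `d` apart, are handled by the pair estimate. -/
theorem norm_mul_rpow_neg_le {δ d M x : ℝ} {z₁ z₂ z₃ : ℂ} (hδ : 0 < δ) (hd : 0 < d)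
    (hM : 0 < M) (h12 : d ≤ ‖z₁ - z₂‖) (h13 : d ≤ ‖z₁ - z₃‖) (h23 : d ≤ ‖z₂ - z₃‖)
    (hmax : M ≤ ‖z₁ - z₂‖ ∨ M ≤ ‖z₁ - z₃‖ ∨ M ≤ ‖z₂ - z₃‖)
    (h1 : x ≠ z₁.re) (h2 : x ≠ z₂.re) (h3 : x ≠ z₃.re) :
    ‖((x : ℂ) - z₁) * (x - z₂) * (x - z₃)‖ ^ (-δ) ≤
      (M / 2) ^ (-δ) * (3 ^ δ * (pairKernel δ d (x - z₁.re) + pairKernel δ d (x - z₂.re) +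
        pairKernel δ d (x - z₃.re))) := by
  have tri : ∀ z w : ℂ, ‖z - w‖ ≤ ‖(x : ℂ) - z‖ + ‖(x : ℂ) - w‖ := fun z w => by
    have := norm_sub_le ((x : ℂ) - w) (x - z)
    rw [sub_sub_sub_cancel_left] at this
    linarith
  have far : M / 2 ≤ ‖(x : ℂ) - z₁‖ ∨ M / 2 ≤ ‖(x : ℂ) - z₂‖ ∨ M / 2 ≤ ‖(x : ℂ) - z₃‖ := by
    have t12 := tri z₁ z₂
    have t13 := tri z₁ z₃
    have t23 := tri z₂ z₃
    by_contra! hcon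
    obtain ⟨c1, c2, c3⟩ := hcon
    rcases hmax with h | h | h <;> linarith
  have small : ∀ {r : ℝ}, M / 2 ≤ r → r ^ (-δ) ≤ (M / 2) ^ (-δ) := fun h =>
    Real.rpow_le_rpow_of_nonpos (by positivity) h (by linarith)
  have k1 := pairKernel_nonneg hd.le δ (x - z₁.re)
  have k2 := pairKernel_nonneg hd.le δ (x - z₂.re)
  have k3 := pairKernel_nonneg hd.le δ (x - z₃.re)
  rw [norm_mul, norm_mul, Real.mul_rpow (by positivity) (by positivity),
    Real.mul_rpow (by positivity) (by positivity)]
  rcases far with h | h | h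
  · rw [mul_assoc]
    refine mul_le_mul (small h) ((rpow_neg_norm_mul_le hδ hd h23 h2 h3).trans ?_)
      (by positivity) (by positivity)
    exact mul_le_mul_of_nonneg_left (by linarith) (by positivity)
  · rw [mul_right_comm, mul_comm]
    refine mul_le_mul (small h) ((rpow_neg_norm_mul_le hδ hd h13 h1 h3).trans ?_)
      (by positivity) (by positivity)
    exact mul_le_mul_of_nonneg_left (by linarith) (by positivity)
  · rw [mul_comm]
    refine mul_le_mul (small h) ((rpow_neg_norm_mul_le hδ hd h12 h1 h2).trans ?_)
      (by positivity) (by positivity)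
    exact mul_le_mul_of_nonneg_left (by linarith) (by positivity)

theorem cubicMass_le_of_roots {δ d M p q : ℝ} {z₁ z₂ z₃ : ℂ} (hδ : 1 / 2 < δ) (hδ1 : δ < 1)
    (hd : 0 < d) (hM : 0 < M) (h12 : d ≤ ‖z₁ - z₂‖) (h13 : d ≤ ‖z₁ - z₃‖)
    (h23 : d ≤ ‖z₂ - z₃‖) (hmax : M ≤ ‖z₁ - z₂‖ ∨ M ≤ ‖z₁ - z₃‖ ∨ M ≤ ‖z₂ - z₃‖)
    (hroots : ∀ x : ℂ, x ^ 3 + p * x + q = (x - z₁) * (x - z₂) * (x - z₃)) :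
    cubicMass p q ≤
      (M / 2) ^ (-δ) * (3 ^ δ * (3 * (d ^ (1 - 2 * δ) * ∫ t, pairKernel δ 1 t))) := by
  have hint : ∀ r : ℝ, Integrable fun x => pairKernel δ d (x - r) := fun r =>
    (integrable_pairKernel hδ hδ1 hd).comp_sub_right r
  have hval : ∀ r : ℝ, ∫ x, pairKernel δ d (x - r) = d ^ (1 - 2 * δ) * ∫ t, pairKernel δ 1 t :=
    fun r => by rw [integral_sub_right_eq_self (pairKernel δ d), integral_pairKernel hd]
  have hsum := (((hint z₁.re).add (hint z₂.re)).add (hint z₃.re)).const_mul (3 ^ δ)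
    |>.const_mul ((M / 2) ^ (-δ))
  have hle : ∀ᵐ x : ℝ, 1 / (1 + |x ^ 3 + p * x + q|) ≤
      (M / 2) ^ (-δ) * (3 ^ δ * (pairKernel δ d (x - z₁.re) + pairKernel δ d (x - z₂.re) +
        pairKernel δ d (x - z₃.re))) := by
    filter_upwards [Measure.ae_ne volume z₁.re, Measure.ae_ne volume z₂.re,
      Measure.ae_ne volume z₃.re] with x h1 h2 h3
    have hne : ∀ z : ℂ, x ≠ z.re → (x : ℂ) - z ≠ 0 := fun z hz h => hz (by
      rw [← sub_eq_zero.1 h, ofReal_re])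
    have habs : |x ^ 3 + p * x + q| = ‖((x : ℂ) - z₁) * (x - z₂) * (x - z₃)‖ := by
      rw [← hroots, ← Real.norm_eq_abs, ← norm_real]
      push_cast
      rfl
    rw [habs]
    refine (one_div_one_add_le_rpow_neg (by linarith) hδ1.le (norm_pos_iff.2
      (mul_ne_zero (mul_ne_zero (hne _ h1) (hne _ h2)) (hne _ h3)))).trans ?_
    exact norm_mul_rpow_neg_le (by linarith) hd hM h12 h13 h23 hmax h1 h2 h3
  calc cubicMass p q
      = ∫ x in Ioc (-1 : ℝ) 1, 1 / (1 + |x ^ 3 + p * x + q|) :=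
        intervalIntegral.integral_of_le (by norm_num)
    _ ≤ ∫ x in Ioc (-1 : ℝ) 1, (M / 2) ^ (-δ) * (3 ^ δ * (pairKernel δ d (x - z₁.re) +
          pairKernel δ d (x - z₂.re) + pairKernel δ d (x - z₃.re))) :=
        setIntegral_mono_ae ((continuous_one_div_one_add_abs_cubic p q).integrableOn_Ioc)
          hsum.integrableOn hle
    _ ≤ ∫ x, (M / 2) ^ (-δ) * (3 ^ δ * (pairKernel δ d (x - z₁.re) +
          pairKernel δ d (x - z₂.re) + pairKernel δ d (x - z₃.re))) := by
        refine setIntegral_le_integral hsum (.of_forall fun x => ?_)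
        have k1 := pairKernel_nonneg hd.le δ (x - z₁.re)
        have k2 := pairKernel_nonneg hd.le δ (x - z₂.re)
        have k3 := pairKernel_nonneg hd.le δ (x - z₃.re)
        show 0 ≤ (M / 2) ^ (-δ) * (3 ^ δ * _)
        positivity
    _ = _ := by
        have hadd : Integrable fun x => pairKernel δ d (x - z₁.re) + pairKernel δ d (x - z₂.re) :=
          (hint _).add (hint _)
        rw [integral_const_mul, integral_const_mul, integral_add hadd (hint _),
          integral_add (hint _) (hint _), hval, hval, hval]
        ring

/-! ### Roots of the cubic: discriminant and size in terms of `d` and `M`. -/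

theorem exists_roots_depressed_cubic (p q : ℂ) : ∃ z₁ z₂ z₃ : ℂ,
    z₁ + z₂ + z₃ = 0 ∧ ∀ x : ℂ, x ^ 3 + p * x + q = (x - z₁) * (x - z₂) * (x - z₃) := by
  obtain ⟨z, hz⟩ : ∃ z : ℂ, z ^ 3 + p * z + q = 0 := by
    have hdeg : (Cubic.toPoly ⟨1, 0, p, q⟩ : Polynomial ℂ).degree = 3 :=
      Cubic.degree_of_a_ne_zero one_ne_zero
    obtain ⟨z, hz⟩ := IsAlgClosed.exists_root (Cubic.toPoly (⟨1, 0, p, q⟩ : Cubic ℂ))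
      (by rw [hdeg]; decide)
    exact ⟨z, by simpa [Cubic.toPoly] using hz⟩
  -- The discriminant of the cofactor `x ^ 2 + z x + (p + z ^ 2)`.
  obtain ⟨s, hs⟩ := IsAlgClosed.exists_pow_nat_eq (z ^ 2 - 4 * (p + z ^ 2)) two_pos
  refine ⟨z, (-z + s) / 2, (-z - s) / 2, by ring, fun x => ?_⟩
  linear_combination hz + (x - z) / 4 * hs

/-- The roots of a real depressed cubic, together with the smallest and the largest distance
between two of them. -/
structure CubicRoots (p q d M : ℝ) (z₁ z₂ z₃ : ℂ) : Prop where
  sum_eq_zero : z₁ + z₂ + z₃ = 0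
  eval_eq : ∀ x : ℂ, x ^ 3 + p * x + q = (x - z₁) * (x - z₂) * (x - z₃)
  le₁₂ : d ≤ ‖z₁ - z₂‖
  le₁₃ : d ≤ ‖z₁ - z₃‖
  le₂₃ : d ≤ ‖z₂ - z₃‖
  le_max₁₂ : ‖z₁ - z₂‖ ≤ M
  le_max₁₃ : ‖z₁ - z₃‖ ≤ M
  le_max₂₃ : ‖z₂ - z₃‖ ≤ M
  min_attained : d = ‖z₁ - z₂‖ ∨ d = ‖z₁ - z₃‖ ∨ d = ‖z₂ - z₃‖
  max_attained : M ≤ ‖z₁ - z₂‖ ∨ M ≤ ‖z₁ - z₃‖ ∨ M ≤ ‖z₂ - z₃‖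

theorem exists_cubicRoots (p q : ℝ) : ∃ d M z₁ z₂ z₃, CubicRoots p q d M z₁ z₂ z₃ := by
  obtain ⟨z₁, z₂, z₃, h0, h⟩ := exists_roots_depressed_cubic p q
  refine ⟨min ‖z₁ - z₂‖ (min ‖z₁ - z₃‖ ‖z₂ - z₃‖), max ‖z₁ - z₂‖ (max ‖z₁ - z₃‖ ‖z₂ - z₃‖),
    z₁, z₂, z₃, h0, h, ?_, ?_, ?_, ?_, ?_, ?_, ?_, ?_⟩
  all_goals grind

namespace CubicRoots

variable {p q d M : ℝ} {z₁ z₂ z₃ : ℂ}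

theorem max_nonneg (h : CubicRoots p q d M z₁ z₂ z₃) : 0 ≤ M :=
  (norm_nonneg _).trans h.le_max₁₂

theorem min_nonneg (h : CubicRoots p q d M z₁ z₂ z₃) : 0 ≤ d := by
  rcases h.min_attained with e | e | e <;> rw [e] <;> exact norm_nonneg _

theorem q_eq (h : CubicRoots p q d M z₁ z₂ z₃) : (q : ℂ) = -(z₁ * z₂ * z₃) := by
  linear_combination h.eval_eq 0

theorem p_eq (h : CubicRoots p q d M z₁ z₂ z₃) : (p : ℂ) = z₁ * z₂ + z₁ * z₃ + z₂ * z₃ := by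
  linear_combination h.eval_eq 1 - h.q_eq - h.sum_eq_zero

theorem cubicDisc_eq (h : CubicRoots p q d M z₁ z₂ z₃) :
    108 * (cubicDisc p q : ℂ) = -((z₁ - z₂) * (z₁ - z₃) * (z₂ - z₃)) ^ 2 := by
  have h3 : z₃ = -z₁ - z₂ := by linear_combination h.sum_eq_zero
  rw [cubicDisc]
  push_cast
  rw [h.p_eq, h.q_eq, h3]
  ring

theorem abs_cubicDisc_eq (h : CubicRoots p q d M z₁ z₂ z₃) :
    108 * |cubicDisc p q| = (‖z₁ - z₂‖ * ‖z₁ - z₃‖ * ‖z₂ - z₃‖) ^ 2 := by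
  have := congrArg norm h.cubicDisc_eq
  simpa [Real.norm_eq_abs] using this

theorem min_pos (h : CubicRoots p q d M z₁ z₂ z₃) (hD : cubicDisc p q ≠ 0) : 0 < d := by
  have h1 := h.abs_cubicDisc_eq
  refine h.min_nonneg.lt_of_ne' fun h0 => ?_
  have : |cubicDisc p q| = 0 := by
    rcases h.min_attained with e | e | e <;> rw [← e, h0] at h1 <;> linarith
  exact hD (abs_eq_zero.1 this)

theorem max_pos (h : CubicRoots p q d M z₁ z₂ z₃) (hD : cubicDisc p q ≠ 0) : 0 < M :=
  (h.min_pos hD).trans_le (h.le₁₂.trans h.le_max₁₂)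

theorem abs_cubicDisc_le (h : CubicRoots p q d M z₁ z₂ z₃) :
    |cubicDisc p q| ≤ (d * M ^ 2) ^ 2 := by
  have h1 := h.abs_cubicDisc_eq
  have hM := h.max_nonneg
  have hd := h.min_nonneg
  have key : ‖z₁ - z₂‖ * ‖z₁ - z₃‖ * ‖z₂ - z₃‖ ≤ d * M ^ 2 := by
    have a := h.le_max₁₂
    have b := h.le_max₁₃
    have c := h.le_max₂₃
    rcases h.min_attained with e | e | e
    · rw [← e, mul_assoc, sq]; gcongr
    · rw [← e, mul_comm _ d, mul_assoc, sq]; gcongr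
    · rw [← e, mul_comm _ d, sq]; gcongr
  have : (‖z₁ - z₂‖ * ‖z₁ - z₃‖ * ‖z₂ - z₃‖) ^ 2 ≤ (d * M ^ 2) ^ 2 := by gcongr
  linarith [abs_nonneg (cubicDisc p q)]

theorem cubicSize_le (h : CubicRoots p q d M z₁ z₂ z₃) : cubicSize p q ≤ 2 * M ^ 6 := by
  have hM := h.max_nonneg
  have third : ∀ a b c : ℂ, a + b + c = 0 → ‖a - b‖ ≤ M → ‖a - c‖ ≤ M → ‖a‖ ≤ M := by
    intro a b c h0 h1 h2
    -- As the roots sum to zero, their differences control the roots themselves.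
    have e : 3 * a = (a - b) + (a - c) := by linear_combination h0
    have := norm_add_le (a - b) (a - c)
    rw [← e, norm_mul] at this
    norm_num at this
    linarith
  have h0 := h.sum_eq_zero
  have n1 := third z₁ z₂ z₃ h0 h.le_max₁₂ h.le_max₁₃
  have n2 := third z₂ z₁ z₃ (by linear_combination h0) (by rw [norm_sub_rev]; exact h.le_max₁₂)
    h.le_max₂₃
  have n3 := third z₃ z₁ z₂ (by linear_combination h0) (by rw [norm_sub_rev]; exact h.le_max₁₃)
    (by rw [norm_sub_rev]; exact h.le_max₂₃)
  have hp : |p| ≤ 3 * M ^ 2 := by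
    rw [← Real.norm_eq_abs, ← norm_real, h.p_eq]
    calc ‖z₁ * z₂ + z₁ * z₃ + z₂ * z₃‖ ≤ ‖z₁‖ * ‖z₂‖ + ‖z₁‖ * ‖z₃‖ + ‖z₂‖ * ‖z₃‖ := by
          simpa only [norm_mul] using norm_add₃_le (a := z₁ * z₂) (b := z₁ * z₃) (c := z₂ * z₃)
      _ ≤ M * M + M * M + M * M := by gcongr
      _ = _ := by ring
  have hq : |q| ≤ M ^ 3 := by
    rw [← Real.norm_eq_abs, ← norm_real, h.q_eq, norm_neg, norm_mul, norm_mul]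
    calc ‖z₁‖ * ‖z₂‖ * ‖z₃‖ ≤ M * M * M := by gcongr
      _ = _ := by ring
  have hp3 : |p| ^ 3 ≤ (3 * M ^ 2) ^ 3 := by gcongr
  have hq2 : |q| ^ 2 ≤ (M ^ 3) ^ 2 := by gcongr
  have hM6 : 0 ≤ M ^ 6 := by positivity
  rw [cubicSize, ← sq_abs q]
  nlinarith

end CubicRoots

/-- Either `|z| ^ 2 ≤ 4 |p|`, or the linear term is absorbed and `|z| ^ 3 ≤ 2 |q|`. The first case
gives `1728 = 64 * 27`. -/
theorem norm_pow_six_le_of_root {p q : ℝ} {z : ℂ} (hz : z ^ 3 + p * z + q = 0) :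
    ‖z‖ ^ 6 ≤ 1728 * cubicSize p q := by
  have h1 : ‖z‖ ^ 3 ≤ |p| * ‖z‖ + |q| := by
    have e : z ^ 3 = -(p * z + q) := by linear_combination hz
    rw [← norm_pow, e, norm_neg]
    simpa [Real.norm_eq_abs] using norm_add_le (p * z : ℂ) q
  have hr := norm_nonneg z
  have hp := abs_nonneg p
  rw [cubicSize, ← sq_abs q]
  rcases le_or_gt (‖z‖ ^ 2) (4 * |p|) with h | h
  · have : (‖z‖ ^ 2) ^ 3 ≤ (4 * |p|) ^ 3 := by gcongr
    nlinarith [sq_nonneg |q|]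
  · have h2 : ‖z‖ ^ 3 ≤ 2 * |q| := by nlinarith [abs_nonneg q, pow_nonneg hr 3]
    have : (‖z‖ ^ 3) ^ 2 ≤ (2 * |q|) ^ 2 := by gcongr
    nlinarith [pow_nonneg hp 3, sq_nonneg |q|]

theorem CubicRoots.max_pow_six_le {p q d M : ℝ} {z₁ z₂ z₃ : ℂ}
    (h : CubicRoots p q d M z₁ z₂ z₃) : M ^ 6 ≤ 110592 * cubicSize p q := by
  have hM := h.max_nonneg
  have main : ∀ z w : ℂ, z ^ 3 + p * z + q = 0 → w ^ 3 + p * w + q = 0 → M ≤ ‖z - w‖ →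
      M ^ 6 ≤ 110592 * cubicSize p q := by
    intro z w hz hw hle
    have hzw := norm_sub_le z w
    obtain ⟨u, hu, hM'⟩ : ∃ u : ℂ, u ^ 3 + p * u + q = 0 ∧ M ≤ 2 * ‖u‖ := by
      rcases le_total ‖z‖ ‖w‖ with hc | hc
      · exact ⟨w, hw, by linarith⟩
      · exact ⟨z, hz, by linarith⟩
    have : M ^ 6 ≤ (2 * ‖u‖) ^ 6 := by gcongr
    have := norm_pow_six_le_of_root hu
    nlinarith
  have r1 : z₁ ^ 3 + p * z₁ + q = 0 := by rw [h.eval_eq]; ring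
  have r2 : z₂ ^ 3 + p * z₂ + q = 0 := by rw [h.eval_eq]; ring
  have r3 : z₃ ^ 3 + p * z₃ + q = 0 := by rw [h.eval_eq]; ring
  rcases h.max_attained with hm | hm | hm
  · exact main _ _ r1 r2 hm
  · exact main _ _ r1 r3 hm
  · exact main _ _ r2 r3 hm

/-- Both comparisons of `cubicSize` with `M ^ 6` are needed, because the exponent `2 - 3δ` to which
this is applied changes sign at `δ = 2/3`. -/
theorem CubicRoots.cubicSize_rpow_le {p q d M : ℝ} {z₁ z₂ z₃ : ℂ}
    (h : CubicRoots p q d M z₁ z₂ z₃) (hM : 0 < M) (e : ℝ) :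
    cubicSize p q ^ (e / 6) ≤ 110592 ^ |e / 6| * M ^ e := by
  have hM6 : (M ^ 6) ^ (e / 6) = M ^ e := by
    rw [← Real.rpow_natCast, ← Real.rpow_mul hM.le,
      show ((6 : ℕ) : ℝ) * (e / 6) = e by push_cast; ring]
  rw [← hM6]
  rcases le_total 0 (e / 6) with he | he
  · rw [abs_of_nonneg he, ← Real.mul_rpow (by norm_num) (by positivity)]
    have hS := h.cubicSize_le
    have hS0 := cubicSize_nonneg p q
    gcongr
    linarith [pow_pos hM 6]
  · rw [abs_of_nonpos he, Real.rpow_neg (by norm_num), ← Real.inv_rpow (by norm_num),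
      ← Real.mul_rpow (by norm_num) (by positivity)]
    refine Real.rpow_le_rpow_of_nonpos (by positivity) ?_ he
    rw [inv_mul_le_iff₀ (by norm_num)]
    exact h.max_pow_six_le

/-! ### The bound for `δ > 1/2`, and the theorem. -/

theorem exists_cubicMass_mul_le {δ : ℝ} (hδ : 1 / 2 < δ) (hδ1 : δ < 1) :
    ∃ K : ℝ, 0 ≤ K ∧ ∀ p q : ℝ, cubicDisc p q ≠ 0 →
      cubicMass p q * (|cubicDisc p q| ^ (δ - 1 / 2) * cubicSize p q ^ ((2 - 3 * δ) / 6)) ≤ K := by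
  set A := ∫ t, pairKernel δ 1 t with hA
  have hA0 : 0 ≤ A := integral_nonneg fun t => pairKernel_nonneg zero_le_one δ t
  refine ⟨(1 / 2) ^ (-δ) * (3 ^ δ * (3 * A)) * 110592 ^ |(2 - 3 * δ) / 6|, by positivity,
    fun p q hD => ?_⟩
  obtain ⟨d, M, z₁, z₂, z₃, h⟩ := exists_cubicRoots p q
  have hd := h.min_pos hD
  have hM := h.max_pos hD
  have hI := cubicMass_le_of_roots hδ hδ1 hd hM h.le₁₂ h.le₁₃ h.le₂₃ h.max_attained h.eval_eq
  rw [← hA] at hI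
  have hS := h.cubicSize_rpow_le hM (2 - 3 * δ)
  have hDle : |cubicDisc p q| ^ (δ - 1 / 2) ≤ d ^ (2 * δ - 1) * M ^ (4 * δ - 2) := by
    calc |cubicDisc p q| ^ (δ - 1 / 2) ≤ ((d * M ^ 2) ^ 2) ^ (δ - 1 / 2) :=
          Real.rpow_le_rpow (abs_nonneg _) h.abs_cubicDisc_le (by linarith)
      _ = _ := by
        rw [mul_pow, Real.mul_rpow (by positivity) (by positivity), ← pow_mul,
          ← Real.rpow_natCast, ← Real.rpow_natCast, ← Real.rpow_mul hd.le, ← Real.rpow_mul hM.le]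
        push_cast
        ring_nf
  have hMδ : (M / 2) ^ (-δ) = M ^ (-δ) * (1 / 2) ^ (-δ) := by
    rw [← Real.mul_rpow hM.le (by norm_num)]; ring_nf
  have hd1 : d ^ (1 - 2 * δ) * d ^ (2 * δ - 1) = 1 := by
    rw [← Real.rpow_add hd]; norm_num
  have hM1 : M ^ (-δ) * (M ^ (4 * δ - 2) * M ^ (2 - 3 * δ)) = 1 := by
    rw [← Real.rpow_add hM, ← Real.rpow_add hM]; ring_nf; exact Real.rpow_zero M
  have hS0 := cubicSize_nonneg p q
  calc cubicMass p q * (|cubicDisc p q| ^ (δ - 1 / 2) * cubicSize p q ^ ((2 - 3 * δ) / 6))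
      ≤ ((M / 2) ^ (-δ) * (3 ^ δ * (3 * (d ^ (1 - 2 * δ) * A)))) *
        ((d ^ (2 * δ - 1) * M ^ (4 * δ - 2)) *
          (110592 ^ |(2 - 3 * δ) / 6| * M ^ (2 - 3 * δ))) := by gcongr
    _ = (1 / 2) ^ (-δ) * (3 ^ δ * (3 * A)) * 110592 ^ |(2 - 3 * δ) / 6| *
        (d ^ (1 - 2 * δ) * d ^ (2 * δ - 1)) *
        (M ^ (-δ) * (M ^ (4 * δ - 2) * M ^ (2 - 3 * δ))) := by rw [hMδ]; ring
    _ = _ := by rw [hd1, hM1, mul_one, mul_one]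

theorem integrableOn_mittagLeffler_cubic {α β : ℝ} (hα : 0 < α) (hβ : 0 < β) (p q : ℝ) :
    IntegrableOn (fun x : ℝ => mittagLeffler (α : ℂ) (β : ℂ)
      (Complex.I * ((x ^ 3 + p * x + q : ℝ) : ℂ))) (Icc (-1 : ℝ) 1) :=
  ((continuous_mittagLeffler hα hβ).comp (by fun_prop)).continuousOn.integrableOn_Icc

theorem cubicSize_pos {p q : ℝ} (h : p ≠ 0 ∨ q ≠ 0) : 0 < cubicSize p q := by
  unfold cubicSize
  rcases h with h | h
  · have := abs_pos.2 h
    positivity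
  · positivity

theorem cubicSize_pos_of_cubicDisc_ne_zero {p q : ℝ} (h : cubicDisc p q ≠ 0) :
    0 < cubicSize p q := by
  refine cubicSize_pos ?_
  by_contra! hcon
  exact h (by simp [cubicDisc, hcon.1, hcon.2])

/-- The first two conjuncts say that the objects involved are well defined (the series converges and
the integrand is integrable); the last two are the estimates. In each estimate the pairs `(p, q)`
for which the denominator on the right vanishes, so that the bound is void, are left out. In the
first estimate with `δ = 1 / 3` the exponent is `0`, the denominator is `1`, and no pair is left
out. -/
theorem theorem3 (α β : ℝ) (hα0 : 0 < α) (hα1 : α < 1) (hβ : 0 < β) :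
    (∀ z : ℂ, Summable fun k : ℕ => z ^ k / Complex.Gamma ((α : ℂ) * k + (β : ℂ))) ∧
    (∀ p q : ℝ, MeasureTheory.IntegrableOn
      (fun x : ℝ =>
        mittagLeffler (α : ℂ) (β : ℂ) (Complex.I * ((x ^ 3 + p * x + q : ℝ) : ℂ)))
      (Set.Icc (-1 : ℝ) 1)) ∧
    (∀ δ : ℝ, 1 / 3 ≤ δ → δ ≤ 1 / 2 →
      ∃ c : ℝ, 0 < c ∧ ∀ p q : ℝ, (p ≠ 0 ∨ q ≠ 0 ∨ δ = 1 / 3) →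
        ‖cubicIntegral α β p q‖ ≤ c / cubicSize p q ^ ((3 * δ - 1) / 6)) ∧
    (∀ δ : ℝ, 1 / 2 < δ → δ < 1 →
      ∃ c : ℝ, 0 < c ∧ ∀ p q : ℝ, cubicDisc p q ≠ 0 →
        ‖cubicIntegral α β p q‖ ≤
          c / (|cubicDisc p q| ^ (δ - 1 / 2) * cubicSize p q ^ ((2 - 3 * δ) / 6))) := by
  obtain ⟨C, hC, hE⟩ := exists_norm_mittagLeffler_le hα0 hα1 hβ
  refine ⟨summable_mittagLeffler hα0 hβ, integrableOn_mittagLeffler_cubic hα0 hβ,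
    fun δ h1 h2 => ?_, fun δ h1 h2 => ?_⟩
  · refine ⟨C * 70, by positivity, fun p q hpq => ?_⟩
    have hpos : 0 < cubicSize p q ^ ((3 * δ - 1) / 6) := by
      rw [← or_assoc] at hpq
      rcases hpq with hpq | rfl
      · exact Real.rpow_pos_of_pos (cubicSize_pos hpq) _
      · norm_num
    rw [le_div_iff₀ hpos]
    calc ‖cubicIntegral α β p q‖ * cubicSize p q ^ ((3 * δ - 1) / 6)
        ≤ C * cubicMass p q * cubicSize p q ^ ((3 * δ - 1) / 6) := by
          gcongr; exact norm_cubicIntegral_le hE p q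
      _ ≤ C * 70 := by
          rw [mul_assoc]
          gcongr
          exact cubicMass_mul_cubicSize_rpow_le (by linarith) (by linarith) p q
  · obtain ⟨K, hK, hle⟩ := exists_cubicMass_mul_le h1 h2
    -- `K` is only known to be nonnegative; `K + 1` makes the constant positive.
    refine ⟨C * (K + 1), by positivity, fun p q hD => ?_⟩
    have hS := cubicSize_pos_of_cubicDisc_ne_zero hD
    have hD' : 0 < |cubicDisc p q| := abs_pos.2 hD
    have hpos : 0 < |cubicDisc p q| ^ (δ - 1 / 2) * cubicSize p q ^ ((2 - 3 * δ) / 6) := by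
      positivity
    rw [le_div_iff₀ hpos]
    calc ‖cubicIntegral α β p q‖ *
          (|cubicDisc p q| ^ (δ - 1 / 2) * cubicSize p q ^ ((2 - 3 * δ) / 6))
        ≤ C * cubicMass p q *
          (|cubicDisc p q| ^ (δ - 1 / 2) * cubicSize p q ^ ((2 - 3 * δ) / 6)) := by
          gcongr; exact norm_cubicIntegral_le hE p q
      _ ≤ C * (K + 1) := by
          rw [mul_assoc]
          gcongr
          linarith [hle p q hD]
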